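/- Call a nonempty set $S\subseteq 2^{\omega}$ a Scott set if (i) whenever $x,y\in S$ and $z\le_T x\oplus y$, also $z\in S$, and (ii) every infinite tree $T\subseteq 2^{<\omega}$ that is computable in some element of $S$ has an infinite path $f\in S$. Fix a Gödel coding of the formulas of the language $\{0,-,+,<\}$ of ordered groups. A structure $M$ in this language is called $S$-saturated if (a) for every $n$, every complete $n$-type over $\emptyset$ (with respect to $\mathrm{Th}(M)$) that is realized in $M$ is computable in some element of $S$; and (b) for every $n$, if $p(x,\overline y)$ is a complete $(n+1)$-type over $\emptyset$ (with respect to $\mathrm{Th}(M)$) that is computable in some element of $S$, $\overline a\in M^n$, and $p(x,\overline a)$ is finitely satisfiable in $M$, then $p(x,\overline a)$ is realized in $M$. **Corollary.** For every Scott set $S$ there is an $S$-saturated nontrivial divisible ordered abelian group. More precisely, let $k_S$ be the set of real numbers $r$ whose cut $\{q\in\mathbb Q : q<r\}$ is computable in some element of $S$. Then $k_S$ is a subfield of $\mathbb R$, and the group of all functions $f:\mathbb Q\to k_S$ with finite support, with coordinatewise addition and the lexicographic order ($f<g$ if and only if $f(q)<g(q)$ at the least $q$ with $f(q)\neq g(q)$),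 is a nontrivial divisible ordered abelian group that is $S$-saturated. -/

import Mathlib

namespace ScottSets

noncomputable section

/-! ### Oracle computability for subsets of countable sets, and Scott sets -/

/-- An element of `2^ω`, viewed as a (total) function `ℕ →. ℕ` with values in `{0, 1}`. -/
def toPFun (x : ℕ → Bool) : ℕ →. ℕ := fun n => Part.some (x n).toNat

/-- `x` is Turing reducible to `y`. -/
def TuringLE (x y : ℕ → Bool) : Prop := TuringReducible (toPFun x) (toPFun y)

/-- The join of `x` and `y`: `x` on the even numbers, `y` on the odd numbers. -/
def join (x y : ℕ → Bool) : ℕ → Bool := fun n => if n % 2 = 0 then x (n / 2) else y (n / 2)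

open Classical in
/-- The characteristic function of a set of natural numbers. -/
def charFun (A : Set ℕ) : ℕ → Bool := fun n => decide (n ∈ A)

/-- With respect to a coding `code : α → ℕ`, the set `A` (more precisely its set of codes)
is computable in some element of `S`. -/
def ComputableInSome (S : Set (ℕ → Bool)) {α : Type} (code : α → ℕ) (A : Set α) : Prop :=
  ∃ x ∈ S, TuringLE (charFun (code '' A)) x

/-- A tree in `2^{<ω}`: a set of finite binary strings closed under initial segments. -/
def IsTree (T : Set (List Bool)) : Prop := ∀ σ ∈ T, ∀ τ : List Bool, τ <+: σ → τ ∈ T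

/-- `f` is an infinite path through `T`: every finite initial segment of `f` is in `T`. -/
def IsPath (f : ℕ → Bool) (T : Set (List Bool)) : Prop := ∀ n : ℕ, (List.range n).map f ∈ T

/-- Scott sets: nonempty Turing ideals that contain an infinite path through each infinite binary
tree computable in one of their elements. Binary strings are coded by the standard
(primitive recursive) coding of lists. -/
structure IsScottSet (S : Set (ℕ → Bool)) : Prop where
  nonempty : S.Nonempty
  ideal : ∀ x ∈ S, ∀ y ∈ S, ∀ z : ℕ → Bool, TuringLE z (join x y) → z ∈ S
  path : ∀ T : Set (List Bool), IsTree T → T.Infinite →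
    ComputableInSome S (Encodable.encode : List Bool → ℕ) T → ∃ f ∈ S, IsPath f T

/-- The coding of a rational number by its numerator and denominator in lowest terms. -/
def ratCode (q : ℚ) : ℕ := Nat.pair (Encodable.encode q.num) q.den

/-- The set of reals computable in some element of `S`, a real being identified with
its cut in the rationals. -/
def realsOf (S : Set (ℕ → Bool)) : Set ℝ :=
  {r | ComputableInSome S ratCode {q : ℚ | (q : ℝ) < r}}

/-! ### The language of ordered groups and its Gödel coding -/

/-- The function symbols `0`, `-`, `+` of the language of ordered groups. -/
inductive OGFunc : ℕ → Type
  | zero : OGFunc 0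
  | neg : OGFunc 1
  | add : OGFunc 2

/-- The relation symbol `<` of the language of ordered groups. -/
inductive OGRel : ℕ → Type
  | lt : OGRel 2

/-- The language `{0, -, +, <}` of ordered groups. -/
def og : FirstOrder.Language.{0, 0} := ⟨OGFunc, OGRel⟩

/-- An ordered group as a structure in the language of ordered groups. -/
instance ogStructure (G : Type) [AddGroup G] [LT G] : og.Structure G where
  funMap {_} f v :=
    match f, v with
    | OGFunc.zero, _ => 0
    | OGFunc.neg, v => -v 0
    | OGFunc.add, v => v 0 + v 1
  RelMap {_} R v :=
    match R, v with
    | OGRel.lt, v => v 0 < v 1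

/-- Gödel codes of terms, given codes of the variables. -/
def termCode {α : Type} (c : α → ℕ) : og.Term α → ℕ
  | .var a => Nat.pair 0 (c a)
  | .func OGFunc.zero _ => Nat.pair 1 0
  | .func OGFunc.neg t => Nat.pair 2 (termCode c (t 0))
  | .func OGFunc.add t => Nat.pair 3 (Nat.pair (termCode c (t 0)) (termCode c (t 1)))

/-- Codes of variables: the `i`-th free variable has code `2 i`, the `j`-th bound variable
has code `2 j + 1`. -/
def varCode {m n : ℕ} : Fin m ⊕ Fin n → ℕ
  | .inl i => 2 * i
  | .inr j => 2 * j + 1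

/-- Gödel codes of formulas of the language of ordered groups. -/
def formulaCode {m : ℕ} : {n : ℕ} → og.BoundedFormula (Fin m) n → ℕ
  | _, .falsum => Nat.pair 0 0
  | _, .equal t u => Nat.pair 1 (Nat.pair (termCode varCode t) (termCode varCode u))
  | _, .rel OGRel.lt t =>
      Nat.pair 2 (Nat.pair (termCode varCode (t 0)) (termCode varCode (t 1)))
  | _, .imp φ ψ => Nat.pair 3 (Nat.pair (formulaCode φ) (formulaCode ψ))
  | _, .all φ => Nat.pair 4 (formulaCode φ)

/-! ### `S`-saturation -/

/-- The formulas in `n` free variables that belong to a complete `n`-type. -/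
def typeFormulas {T : og.Theory} {n : ℕ} (p : T.CompleteType (Fin n)) :
    Set (og.Formula (Fin n)) :=
  {φ | FirstOrder.Language.Formula.equivSentence φ ∈ p}

/-- `M` is `S`-saturated: every complete type over `∅` realized in `M` is computable in some
element of `S`, and if `p(x, y₁, …, yₙ)` is a complete type over `∅` computable in some element
of `S` such that `p(x, a₁, …, aₙ)` is finitely satisfiable in `M`, then `p(x, a₁, …, aₙ)` is
realized in `M`. Types are taken with respect to the complete theory of `M`. -/
structure IsSSaturated (S : Set (ℕ → Bool)) (M : Type) [og.Structure M] [Nonempty M] : Prop where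
  realized_computable : ∀ (n : ℕ) (p : (og.completeTheory M).CompleteType (Fin n)),
    p ∈ (og.completeTheory M).realizedTypes M (Fin n) →
      ComputableInSome S formulaCode (typeFormulas p)
  computable_realized : ∀ (n : ℕ) (p : (og.completeTheory M).CompleteType (Fin (n + 1)))
    (a : Fin n → M), ComputableInSome S formulaCode (typeFormulas p) →
      (∀ F : Finset (og.Formula (Fin (n + 1))), (F : Set (og.Formula (Fin (n + 1)))) ⊆
        typeFormulas p → ∃ b : M, ∀ φ ∈ F, φ.Realize (Fin.cons b a : Fin (n + 1) → M)) →
      ∃ b : M, ∀ φ ∈ typeFormulas p, φ.Realize (Fin.cons b a : Fin (n + 1) → M)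

/-- `G` is a nontrivial divisible ordered abelian group. -/
structure IsDivisibleOrderedAbelianGroup (G : Type) [AddCommGroup G] [LinearOrder G] : Prop where
  isOrdered : IsOrderedAddMonoid G
  nontrivial : Nontrivial G
  divisible : ∀ n : ℕ, n ≠ 0 → ∀ g : G, ∃ h : G, n • h = g

end

end ScottSets

namespace ScottSets

noncomputable section

/-! ### Automation for primitive recursive functions -/

attribute [fun_prop] Primrec
attribute [fun_prop] Primrec.id Primrec.const Primrec.comp

section PrimrecClosure

variable {α β γ σ : Type*} [Primcodable α] [Primcodable β] [Primcodable γ] [Primcodable σ]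

namespace PR

@[fun_prop]
theorem id' : Primrec (fun x : α => x) := Primrec.id

@[fun_prop]
theorem fst {f : α → β × γ} (hf : Primrec f) : Primrec (fun x => (f x).1) := Primrec.fst.comp hf

@[fun_prop]
theorem snd {f : α → β × γ} (hf : Primrec f) : Primrec (fun x => (f x).2) := Primrec.snd.comp hf

@[fun_prop]
theorem pair {f : α → β} {g : α → γ} (hf : Primrec f) (hg : Primrec g) :
    Primrec (fun x => (f x, g x)) := Primrec.pair hf hg

@[fun_prop]
theorem unpair {f : α → ℕ} (hf : Primrec f) : Primrec (fun x => (f x).unpair) :=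
  Primrec.unpair.comp hf

@[fun_prop]
theorem natPair {f g : α → ℕ} (hf : Primrec f) (hg : Primrec g) :
    Primrec (fun x => Nat.pair (f x) (g x)) := Primrec₂.natPair.comp hf hg

@[fun_prop]
theorem add {f g : α → ℕ} (hf : Primrec f) (hg : Primrec g) :
    Primrec (fun x => f x + g x) := Primrec.nat_add.comp hf hg

@[fun_prop]
theorem sub {f g : α → ℕ} (hf : Primrec f) (hg : Primrec g) :
    Primrec (fun x => f x - g x) := Primrec.nat_sub.comp hf hg

@[fun_prop]
theorem mul {f g : α → ℕ} (hf : Primrec f) (hg : Primrec g) :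
    Primrec (fun x => f x * g x) := Primrec.nat_mul.comp hf hg

@[fun_prop]
theorem div {f g : α → ℕ} (hf : Primrec f) (hg : Primrec g) :
    Primrec (fun x => f x / g x) := Primrec.nat_div.comp hf hg

@[fun_prop]
theorem mod {f g : α → ℕ} (hf : Primrec f) (hg : Primrec g) :
    Primrec (fun x => f x % g x) := Primrec.nat_mod.comp hf hg

@[fun_prop]
theorem some {f : α → β} (hf : Primrec f) : Primrec (fun x => Option.some (f x)) :=
  Primrec.option_some.comp hf

@[fun_prop]
theorem encode {f : α → β} (hf : Primrec f) : Primrec (fun x => Encodable.encode (f x)) :=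
  Primrec.encode.comp hf

@[fun_prop]
theorem decode₂ {f : α → ℕ} (hf : Primrec f) : Primrec (fun x => Encodable.decode₂ β (f x)) :=
  Primrec.decode₂.comp hf

@[fun_prop]
theorem decode {f : α → ℕ} (hf : Primrec f) :
    Primrec (fun x => (Encodable.decode (f x) : Option β)) :=
  Primrec.decode.comp hf

@[fun_prop]
theorem cons {f : α → β} {g : α → List β} (hf : Primrec f) (hg : Primrec g) :
    Primrec (fun x => f x :: g x) := Primrec.list_cons.comp hf hg

@[fun_prop]
theorem append {f g : α → List β} (hf : Primrec f) (hg : Primrec g) :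
    Primrec (fun x => f x ++ g x) := Primrec.list_append.comp hf hg

@[fun_prop]
theorem length {f : α → List β} (hf : Primrec f) : Primrec (fun x => (f x).length) :=
  Primrec.list_length.comp hf

@[fun_prop]
theorem range {f : α → ℕ} (hf : Primrec f) : Primrec (fun x => List.range (f x)) :=
  Primrec.list_range.comp hf

@[fun_prop]
theorem getElem? {f : α → List β} {g : α → ℕ} (hf : Primrec f) (hg : Primrec g) :
    Primrec (fun x => (f x)[g x]?) := Primrec.list_getElem?.comp hf hg

@[fun_prop]
theorem getD {f : α → List β} {g : α → ℕ} {d : β} (hf : Primrec f) (hg : Primrec g) :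
    Primrec (fun x => (f x).getD (g x) d) := (Primrec.list_getD d).comp hf hg

@[fun_prop]
theorem map {f : α → List β} {g : α → β → γ} (hf : Primrec f)
    (hg : Primrec fun p : α × β => g p.1 p.2) : Primrec (fun x => (f x).map (g x)) :=
  Primrec.list_map hf hg

@[fun_prop]
theorem flatMap {f : α → List β} {g : α → β → List γ} (hf : Primrec f)
    (hg : Primrec fun p : α × β => g p.1 p.2) : Primrec (fun x => (f x).flatMap (g x)) :=
  Primrec.list_flatMap hf hg

@[fun_prop]
theorem foldr {f : α → List β} {g : α → γ} {h : α → β → γ → γ} (hf : Primrec f)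
    (hg : Primrec g) (hh : Primrec fun p : α × β × γ => h p.1 p.2.1 p.2.2) :
    Primrec (fun x => (f x).foldr (h x) (g x)) :=
  Primrec.list_foldr (h := fun a p => h a p.1 p.2) hf hg hh

@[fun_prop]
theorem cond {c : α → Bool} {f g : α → β} (hc : Primrec c) (hf : Primrec f) (hg : Primrec g) :
    Primrec (fun x => bif c x then f x else g x) := Primrec.cond hc hf hg

@[fun_prop]
theorem and {f g : α → Bool} (hf : Primrec f) (hg : Primrec g) :
    Primrec (fun x => f x && g x) := Primrec.and.comp hf hg

@[fun_prop]
theorem or {f g : α → Bool} (hf : Primrec f) (hg : Primrec g) :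
    Primrec (fun x => f x || g x) := Primrec.or.comp hf hg

@[fun_prop]
theorem not {f : α → Bool} (hf : Primrec f) : Primrec (fun x => !(f x)) := Primrec.not.comp hf

@[fun_prop]
theorem decideEq {f g : α → β} [∀ x, Decidable (f x = g x)] (hf : Primrec f) (hg : Primrec g) :
    Primrec (fun x => decide (f x = g x)) :=
  PrimrecPred.decide (PrimrecRel.comp Primrec.eq hf hg)

@[fun_prop]
theorem decideLt {f g : α → ℕ} (hf : Primrec f) (hg : Primrec g) :
    Primrec (fun x => decide (f x < g x)) :=
  PrimrecPred.decide (PrimrecRel.comp Primrec.nat_lt hf hg)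

@[fun_prop]
theorem decideLe {f g : α → ℕ} (hf : Primrec f) (hg : Primrec g) :
    Primrec (fun x => decide (f x ≤ g x)) :=
  PrimrecPred.decide (PrimrecRel.comp Primrec.nat_le hf hg)

@[fun_prop]
theorem any {f : α → List β} {g : α → β → Bool} (hf : Primrec f)
    (hg : Primrec fun p : α × β => g p.1 p.2) : Primrec (fun x => (f x).any (g x)) := by
  have : Primrec fun x => (f x).foldr (fun b r => g x b || r) false :=
    foldr hf (Primrec.const _) (or (hg.comp (pair (fst id') (fst (snd id')))) (snd (snd id')))
  refine this.of_eq fun x => ?_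
  induction f x <;> simp_all

@[fun_prop]
theorem all {f : α → List β} {g : α → β → Bool} (hf : Primrec f)
    (hg : Primrec fun p : α × β => g p.1 p.2) : Primrec (fun x => (f x).all (g x)) := by
  have : Primrec fun x => (f x).foldr (fun b r => g x b && r) true :=
    foldr hf (Primrec.const _) (and (hg.comp (pair (fst id') (fst (snd id')))) (snd (snd id')))
  refine this.of_eq fun x => ?_
  induction f x <;> simp_all

@[fun_prop]
theorem filter {f : α → List β} {g : α → β → Bool} (hf : Primrec f)
    (hg : Primrec fun p : α × β => g p.1 p.2) : Primrec (fun x => (f x).filter (g x)) := by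
  have : Primrec fun x => (f x).foldr (fun b r => bif g x b then b :: r else r) [] :=
    foldr hf (Primrec.const _) (cond (hg.comp (pair (fst id') (fst (snd id'))))
      (cons (fst (snd id')) (snd (snd id'))) (snd (snd id')))
  refine this.of_eq fun x => ?_
  induction f x with
  | nil => rfl
  | cons b l ih => simp only [List.foldr_cons, ih, List.filter_cons]; cases g x b <;> rfl

@[fun_prop]
theorem optionBind {f : α → Option β} {g : α → β → Option γ} (hf : Primrec f)
    (hg : Primrec fun p : α × β => g p.1 p.2) : Primrec (fun x => (f x).bind (g x)) :=
  Primrec.option_bind hf hg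

@[fun_prop]
theorem optionMap {f : α → Option β} {g : α → β → γ} (hf : Primrec f)
    (hg : Primrec fun p : α × β => g p.1 p.2) : Primrec (fun x => (f x).map (g x)) :=
  Primrec.option_map hf hg

@[fun_prop]
theorem optionElim {f : α → Option β} {d : α → γ} {g : α → β → γ} (hf : Primrec f)
    (hd : Primrec d) (hg : Primrec fun p : α × β => g p.1 p.2) :
    Primrec (fun x => (f x).elim (d x) (g x)) :=
  (Primrec.option_casesOn (g := g) hf hd hg).of_eq fun x => by cases f x <;> rfl

end PR

end PrimrecClosure

/-! ### Searching with an oracle -/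

/-- The initial segment of length `m` of `x`. -/
def initSeg (x : ℕ → Bool) (m : ℕ) : List Bool := (List.range m).map x

theorem initSeg_succ (x : ℕ → Bool) (m : ℕ) : initSeg x (m + 1) = initSeg x m ++ [x m] := by
  simp [initSeg, List.range_succ]

theorem initSeg_getElem? (x : ℕ → Bool) (m k : ℕ) :
    (initSeg x m)[k]? = if k < m then some (x k) else none := by
  split_ifs with h <;> simp [initSeg, h]

/-- A total function that is recursive in a set of oracles. -/
def TotalIn (O : Set (ℕ →. ℕ)) (f : ℕ → ℕ) : Prop := Nat.RecursiveIn O fun n => Part.some (f n)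

namespace TotalIn

variable {O : Set (ℕ →. ℕ)} {f g : ℕ → ℕ}

theorem of_primrec (hf : Primrec f) : TotalIn O f := (Primrec.nat_iff.1 hf).recursiveIn

theorem comp (hf : TotalIn O f) (hg : TotalIn O g) : TotalIn O fun n => f (g n) :=
  (Nat.RecursiveIn.comp hf hg).of_eq fun n => by simp

theorem pair (hf : TotalIn O f) (hg : TotalIn O g) : TotalIn O fun n => Nat.pair (f n) (g n) :=
  (Nat.RecursiveIn.pair hf hg).of_eq fun n => by simp [Seq.seq]

theorem iterate {a : ℕ} {h : ℕ → ℕ → ℕ} (hh : TotalIn O fun p => h p.unpair.1 p.unpair.2)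
    {r : ℕ → ℕ} (h0 : r 0 = a) (hr : ∀ n, r (n + 1) = h n (r n)) : TotalIn O r := by
  have h1 : TotalIn O fun p => h p.unpair.2.unpair.1 p.unpair.2.unpair.2 :=
    hh.comp (of_primrec (f := fun p => p.unpair.2) (by fun_prop))
  have h2 := Nat.RecursiveIn.prec (of_primrec (O := O) (f := fun _ => a) (by fun_prop)) h1
  -- Primitive recursion carries a parameter in its first component; it is fixed here at the dummy
  -- value `0`.
  have h3 := Nat.RecursiveIn.comp h2
    (of_primrec (O := O) (f := fun n => Nat.pair 0 n) (by fun_prop))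
  refine Nat.RecursiveIn.of_eq h3 fun n => ?_
  simp only [Part.bind_eq_bind, Part.bind_some, Nat.unpair_pair]
  induction n with
  | zero => simp [h0]
  | succ n ih => simp only [hr]; rw [ih]; simp

theorem find {t : ℕ → ℕ} (ht : TotalIn O t) (h : ∀ n, ∃ k, t (Nat.pair n k) = 0) :
    ∃ r, TotalIn O r ∧ ∀ n, t (Nat.pair n (r n)) = 0 := by
  refine ⟨fun n => Nat.find (h n), (Nat.RecursiveIn.rfind ht).of_eq_tot fun n => ?_,
    fun n => Nat.find_spec (h n)⟩
  refine Nat.mem_rfind.2 ⟨by simp [Nat.find_spec (h n)], fun {m} hm => ?_⟩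
  simp [Nat.find_min (h n) hm]

theorem initSeg {x : ℕ → Bool} (hx : TotalIn O fun n => (x n).toNat) :
    TotalIn O fun m => Encodable.encode (initSeg x m) := by
  -- Appending a bit is primitive recursive on codes; the bit is recovered from its numerical value
  -- by the test `= 1`. The default `[]` for undecodable input is never reached in the iteration.
  have happ : TotalIn O fun p => Encodable.encode
      (((Encodable.decode p.unpair.1 : Option (List Bool)).elim [] id) ++
        [decide (p.unpair.2 = 1)]) := of_primrec (by fun_prop)
  have h : TotalIn O fun p => Encodable.encode
      (((Encodable.decode p.unpair.2 : Option (List Bool)).elim [] id) ++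
        [x p.unpair.1]) := by
    have := happ.comp ((of_primrec (f := fun p => p.unpair.2) (by fun_prop)).pair
      (hx.comp (of_primrec (f := fun p => p.unpair.1) (by fun_prop))))
    simpa using this
  refine iterate (a := Encodable.encode ([] : List Bool)) (h := fun n c => Encodable.encode
      (((Encodable.decode c : Option (List Bool)).elim [] id) ++ [x n])) h (by rfl) fun n => ?_
  simp [initSeg_succ]

end TotalIn

theorem turingLE_iff_totalIn {x y : ℕ → Bool} :
    TuringLE x y ↔ TotalIn {toPFun y} fun n => (x n).toNat := RecursiveIn.iff_nat

theorem turingLE_join_left (x y : ℕ → Bool) : TuringLE x (join x y) := by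
  rw [turingLE_iff_totalIn]
  have h : TotalIn {toPFun (join x y)} fun n => (join x y n).toNat := .oracle _ rfl
  simpa [join] using h.comp (.of_primrec (f := fun n => 2 * n) (by fun_prop))

theorem turingLE_join_right (x y : ℕ → Bool) : TuringLE y (join x y) := by
  rw [turingLE_iff_totalIn]
  have h : TotalIn {toPFun (join x y)} fun n => (join x y n).toNat := .oracle _ rfl
  have := h.comp (.of_primrec (f := fun n => 2 * n + 1) (by fun_prop))
  simpa [join, Nat.add_mod, show ∀ n, (2 * n + 1) / 2 = n by omega] using this

/-- If membership and non-membership in `z` are witnessed by finite searches with access to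
initial segments of `x` and `y`, then `z` is computable in the join of `x` and `y`. -/
theorem turingLE_join_of_search {x y z : ℕ → Bool}
    {p q : ℕ × ℕ × List Bool × List Bool → Bool} (hp : Primrec p) (hq : Primrec q)
    (h1 : ∀ n k m, p (n, k, initSeg x m, initSeg y m) → z n = true)
    (h2 : ∀ n k m, q (n, k, initSeg x m, initSeg y m) → z n = false)
    (h3 : ∀ n, z n = true → ∃ k m, p (n, k, initSeg x m, initSeg y m))
    (h4 : ∀ n, z n = false → ∃ k m, q (n, k, initSeg x m, initSeg y m)) :
    TuringLE z (join x y) := by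
  rw [turingLE_iff_totalIn]
  have hx := TotalIn.initSeg (turingLE_iff_totalIn.1 (turingLE_join_left x y))
  have hy := TotalIn.initSeg (turingLE_iff_totalIn.1 (turingLE_join_right x y))
  have hm : TotalIn {toPFun (join x y)} fun c => c.unpair.2.unpair.2 :=
    .of_primrec (by fun_prop)
  have harg : TotalIn {toPFun (join x y)} fun c => Encodable.encode
      (c.unpair.1, c.unpair.2.unpair.1, initSeg x c.unpair.2.unpair.2,
        initSeg y c.unpair.2.unpair.2) := by
    have := (TotalIn.of_primrec (O := {toPFun (join x y)}) (f := fun c => c.unpair.1)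
      (by fun_prop)).pair ((TotalIn.of_primrec (O := {toPFun (join x y)})
        (f := fun c => c.unpair.2.unpair.1) (by fun_prop)).pair ((hx.comp hm).pair (hy.comp hm)))
    simpa using this
  have lift : ∀ {r : ℕ × ℕ × List Bool × List Bool → Bool}, Primrec r →
      TotalIn {toPFun (join x y)} fun c => (r (c.unpair.1, c.unpair.2.unpair.1,
        initSeg x c.unpair.2.unpair.2, initSeg y c.unpair.2.unpair.2)).toNat := by
    intro r hr
    have h : TotalIn {toPFun (join x y)} fun d =>
        (((Encodable.decode d : Option (ℕ × ℕ × List Bool × List Bool)).elim false r)).toNat :=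
      .of_primrec ((Primrec.dom_bool Bool.toNat).comp (by fun_prop))
    have := h.comp harg
    simpa only [Encodable.encodek, Option.elim_some] using this
  -- Search for a stage at which `p` or `q` accepts. The search looks for a zero, hence the
  -- negation; it ends because every `n` has a witness on one side.
  obtain ⟨s, hs, hs0⟩ := (lift (r := fun c => !(p c || q c)) (by fun_prop)).find (fun n => by
    have : ∃ k m, (p (n, k, initSeg x m, initSeg y m) || q (n, k, initSeg x m, initSeg y m)) := by
      cases hz : z n
      · obtain ⟨k, m, h⟩ := h4 n hz
        exact ⟨k, m, by simp [h]⟩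
      · obtain ⟨k, m, h⟩ := h3 n hz
        exact ⟨k, m, by simp [h]⟩
    obtain ⟨k, m, h⟩ := this
    exact ⟨Nat.pair k m, by simp [h]⟩)
  -- At the stage found, the answer of `p` alone is `z n`, since neither test ever errs.
  have := (lift hp).comp ((TotalIn.of_primrec (f := fun n => n) (by fun_prop)).pair hs)
  convert this using 3 with n
  specialize hs0 n
  simp only [Nat.unpair_pair] at hs0 ⊢
  cases hz : z n
  · cases hpn : p (n, (s n).unpair.1, initSeg x (s n).unpair.2, initSeg y (s n).unpair.2)
    · rfl
    · exact absurd (h1 _ _ _ hpn) (by simp [hz])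
  · cases hpn : p (n, (s n).unpair.1, initSeg x (s n).unpair.2, initSeg y (s n).unpair.2)
    · rw [hpn] at hs0
      have : q (n, (s n).unpair.1, initSeg x (s n).unpair.2, initSeg y (s n).unpair.2) := by
        by_contra hc
        simp [hc] at hs0
      exact absurd (h2 _ _ _ this) (by simp [hz])
    · rfl

end

noncomputable section

/-! ### Predicates decidable in a Scott set -/

variable {α β γ δ : Type} [Primcodable α] [Primcodable β] [Primcodable γ] [Primcodable δ]

/-- The predicate `A` is decidable in some element of `S` (equivalently, its characteristic
function belongs to `S`). -/
def DecIn (S : Set (ℕ → Bool)) (A : α → Prop) : Prop :=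
  charFun (Encodable.encode '' {a | A a}) ∈ S

theorem charFun_encode (A : α → Prop) (a : α) :
    charFun (Encodable.encode '' {a | A a}) (Encodable.encode a) = true ↔ A a := by
  simp [charFun]

theorem charFun_eq_true {A : Set ℕ} {n : ℕ} : charFun A n = true ↔ n ∈ A := by simp [charFun]

theorem charFun_eq_false {A : Set ℕ} {n : ℕ} : charFun A n = false ↔ n ∉ A := by simp [charFun]

theorem initSeg_charFun_true {A : α → Prop} {a : α} {m : ℕ}
    (h : (initSeg (charFun (Encodable.encode '' {a | A a})) m)[Encodable.encode a]? = some true) :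
    A a := by
  rw [initSeg_getElem?] at h
  split_ifs at h
  exact (charFun_encode A a).1 (by simpa using h)

theorem initSeg_charFun_false {A : α → Prop} {a : α} {m : ℕ}
    (h : (initSeg (charFun (Encodable.encode '' {a | A a})) m)[Encodable.encode a]? = some false) :
    ¬ A a := by
  rw [initSeg_getElem?] at h
  split_ifs at h
  rw [← charFun_encode A a]
  simp_all

theorem initSeg_charFun_of {A : α → Prop} {a : α} {m : ℕ} (hm : Encodable.encode a < m) (ha : A a) :
    (initSeg (charFun (Encodable.encode '' {a | A a})) m)[Encodable.encode a]? = some true := by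
  rw [initSeg_getElem?, if_pos hm, (charFun_encode A a).2 ha]

theorem initSeg_charFun_of_not {A : α → Prop} {a : α} {m : ℕ} (hm : Encodable.encode a < m)
    (ha : ¬ A a) :
    (initSeg (charFun (Encodable.encode '' {a | A a})) m)[Encodable.encode a]? = some false := by
  rw [initSeg_getElem?, if_pos hm]
  rw [← charFun_encode A a] at ha
  simpa using ha

variable {S : Set (ℕ → Bool)}

namespace IsScottSet

theorem mem_of_le (hS : IsScottSet S) {x y : ℕ → Bool} (hx : x ∈ S) (h : TuringLE y x) : y ∈ S :=
  hS.ideal x hx x hx y (TuringReducible.trans h (turingLE_join_left x x))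

/-- Carries the search criterion over from numbers to encoded types. `decode₂` is used because it
succeeds exactly on the range of `encode`. -/
theorem decIn_of_search (hS : IsScottSet S) {x y : ℕ → Bool} (hx : x ∈ S) (hy : y ∈ S)
    {A : α → Prop} {p q : α × β × List Bool × List Bool → Bool} (hp : Primrec p) (hq : Primrec q)
    (h1 : ∀ a b m, p (a, b, initSeg x m, initSeg y m) → A a)
    (h2 : ∀ a b m, q (a, b, initSeg x m, initSeg y m) → ¬ A a)
    (h3 : ∀ a, A a → ∃ b m, p (a, b, initSeg x m, initSeg y m))
    (h4 : ∀ a, ¬ A a → ∃ b m, q (a, b, initSeg x m, initSeg y m)) : DecIn S A := by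
  refine hS.ideal x hx y hy _ (turingLE_join_of_search
    (p := fun c => (Encodable.decode₂ α c.1).elim false fun a =>
      (Encodable.decode₂ β c.2.1).elim false fun b => p (a, b, c.2.2.1, c.2.2.2))
    -- The default `true` rejects at once the numbers that code no element of `α`.
    (q := fun c => (Encodable.decode₂ α c.1).elim true fun a =>
      (Encodable.decode₂ β c.2.1).elim false fun b => q (a, b, c.2.2.1, c.2.2.2))
    (by fun_prop) (by fun_prop) ?_ ?_ ?_ ?_)
  · intro n k m h
    rcases ha : Encodable.decode₂ α n with _ | a
    · simp [ha] at h
    rcases hb : Encodable.decode₂ β k with _ | b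
    · simp [ha, hb] at h
    rw [Encodable.decode₂_eq_some] at ha
    simp only [← ha, Encodable.encodek₂, hb, Option.elim_some] at h
    rw [← ha, charFun_encode]
    exact h1 _ _ _ h
  · intro n k m h
    rw [charFun_eq_false]
    rintro ⟨a, haA, rfl⟩
    rcases hb : Encodable.decode₂ β k with _ | b
    · simp [hb] at h
    · simp only [Encodable.encodek₂, hb, Option.elim_some] at h
      exact h2 _ _ _ h haA
  · intro n h
    rw [charFun_eq_true] at h
    obtain ⟨a, ha, rfl⟩ := h
    obtain ⟨b, m, hb⟩ := h3 a ha
    exact ⟨Encodable.encode b, m, by simpa⟩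
  · intro n h
    rw [charFun_eq_false] at h
    rcases ha : Encodable.decode₂ α n with _ | a
    · exact ⟨0, 0, by simp [ha]⟩
    · rw [Encodable.decode₂_eq_some] at ha
      obtain ⟨b, m, hb⟩ := h4 a (fun haA => h ⟨a, haA, ha⟩)
      exact ⟨Encodable.encode b, m, by simpa [← ha]⟩

theorem decIn_primrec (hS : IsScottSet S) {p : α → Bool} (hp : Primrec p) :
    DecIn S fun a => p a = true := by
  obtain ⟨x, hx⟩ := hS.nonempty
  exact hS.decIn_of_search hx hx (β := ℕ) (p := fun c => p c.1) (q := fun c => !(p c.1))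
    (by fun_prop) (by fun_prop) (by simp) (by simp) (by simp) (by simp)

end IsScottSet

namespace DecIn

/-- A predicate which is both existential and universal over decidable predicates is decidable. -/
theorem delta (hS : IsScottSet S) {P Q : α × β → Prop} (hP : DecIn S P) (hQ : DecIn S Q)
    {A : α → Prop} (h : ∀ a, A a ↔ ∃ b, P (a, b)) (h' : ∀ a, ¬ A a ↔ ∃ b, Q (a, b)) :
    DecIn S A := by
  refine hS.decIn_of_search hP hQ (β := β)
    (p := fun c => decide (c.2.2.1[Encodable.encode (c.1, c.2.1)]? = some true))
    (q := fun c => decide (c.2.2.2[Encodable.encode (c.1, c.2.1)]? = some true))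
    (by fun_prop) (by fun_prop) ?_ ?_ ?_ ?_
  · intro a b m hab
    exact (h a).2 ⟨b, initSeg_charFun_true (of_decide_eq_true hab)⟩
  · intro a b m hab
    exact (h' a).2 ⟨b, initSeg_charFun_true (of_decide_eq_true hab)⟩
  · intro a ha
    obtain ⟨b, hb⟩ := (h a).1 ha
    exact ⟨b, Encodable.encode (a, b) + 1,
      decide_eq_true (initSeg_charFun_of (Nat.lt_succ_self _) hb)⟩
  · intro a ha
    obtain ⟨b, hb⟩ := (h' a).1 ha
    exact ⟨b, Encodable.encode (a, b) + 1,
      decide_eq_true (initSeg_charFun_of (Nat.lt_succ_self _) hb)⟩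

/-- Only one oracle bit is read, so the searched witness is a dummy number, and an initial segment
of length one more than the queried code suffices. The connectives below work in the same way. -/
theorem comp (hS : IsScottSet S) {P : β → Prop} (hP : DecIn S P) {f : α → β} (hf : Primrec f) :
    DecIn S fun a => P (f a) := by
  refine hS.decIn_of_search hP hP (β := ℕ)
    (p := fun c => decide (c.2.2.1[Encodable.encode (f c.1)]? = some true))
    (q := fun c => decide (c.2.2.1[Encodable.encode (f c.1)]? = some false))
    (by fun_prop) (by fun_prop) ?_ ?_ ?_ ?_
  · exact fun a b m h => initSeg_charFun_true (of_decide_eq_true h)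
  · exact fun a b m h => initSeg_charFun_false (of_decide_eq_true h)
  · exact fun a ha => ⟨0, Encodable.encode (f a) + 1, decide_eq_true
      (initSeg_charFun_of (Nat.lt_succ_self _) ha)⟩
  · exact fun a ha => ⟨0, Encodable.encode (f a) + 1, decide_eq_true
      (initSeg_charFun_of_not (Nat.lt_succ_self _) ha)⟩

theorem not (hS : IsScottSet S) {P : α → Prop} (hP : DecIn S P) : DecIn S fun a => ¬ P a := by
  refine hS.decIn_of_search hP hP (β := ℕ)
    (p := fun c => decide (c.2.2.1[Encodable.encode c.1]? = some false))
    (q := fun c => decide (c.2.2.1[Encodable.encode c.1]? = some true))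
    (by fun_prop) (by fun_prop) ?_ ?_ ?_ ?_
  · exact fun a b m h => initSeg_charFun_false (of_decide_eq_true h)
  · exact fun a b m h => not_not.2 (initSeg_charFun_true (of_decide_eq_true h))
  · exact fun a ha => ⟨0, Encodable.encode a + 1, decide_eq_true
      (initSeg_charFun_of_not (Nat.lt_succ_self _) ha)⟩
  · exact fun a ha => ⟨0, Encodable.encode a + 1, decide_eq_true
      (initSeg_charFun_of (Nat.lt_succ_self _) (not_not.1 ha))⟩

theorem and (hS : IsScottSet S) {P Q : α → Prop} (hP : DecIn S P) (hQ : DecIn S Q) :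
    DecIn S fun a => P a ∧ Q a := by
  refine hS.decIn_of_search hP hQ (β := ℕ)
    (p := fun c => decide (c.2.2.1[Encodable.encode c.1]? = some true) &&
      decide (c.2.2.2[Encodable.encode c.1]? = some true))
    (q := fun c => decide (c.2.2.1[Encodable.encode c.1]? = some false) ||
      decide (c.2.2.2[Encodable.encode c.1]? = some false))
    (by fun_prop) (by fun_prop) ?_ ?_ ?_ ?_
  · intro a b m h
    simp only [Bool.and_eq_true, decide_eq_true_eq] at h
    exact ⟨initSeg_charFun_true h.1, initSeg_charFun_true h.2⟩
  · intro a b m h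
    simp only [Bool.or_eq_true, decide_eq_true_eq] at h
    rintro ⟨h1, h2⟩
    exact h.elim (initSeg_charFun_false · h1) (initSeg_charFun_false · h2)
  · intro a ha
    refine ⟨0, Encodable.encode a + 1, ?_⟩
    simp only [Bool.and_eq_true, decide_eq_true_eq]
    exact ⟨initSeg_charFun_of (Nat.lt_succ_self _) ha.1,
      initSeg_charFun_of (Nat.lt_succ_self _) ha.2⟩
  · intro a ha
    refine ⟨0, Encodable.encode a + 1, ?_⟩
    simp only [Bool.or_eq_true, decide_eq_true_eq]
    exact (not_and_or.1 ha).imp (initSeg_charFun_of_not (Nat.lt_succ_self _))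
      (initSeg_charFun_of_not (Nat.lt_succ_self _))

theorem of_iff {P Q : α → Prop} (hP : DecIn S P) (h : ∀ a, Q a ↔ P a) : DecIn S Q := by
  rwa [show Q = P from funext fun a => propext (h a)]

theorem or (hS : IsScottSet S) {P Q : α → Prop} (hP : DecIn S P) (hQ : DecIn S Q) :
    DecIn S fun a => P a ∨ Q a :=
  of_iff (((hP.not hS).and hS (hQ.not hS)).not hS) fun a => by tauto

theorem exists_bound (l : List β) : ∃ m, ∀ b ∈ l, Encodable.encode b < m := by
  refine ⟨(l.map Encodable.encode).sum + 1, fun b hb => Nat.lt_succ_of_le ?_⟩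
  exact List.le_sum_of_mem (List.mem_map_of_mem hb)

theorem forall_mem (hS : IsScottSet S) {P : α × β → Prop} (hP : DecIn S P) {f : α → List β}
    (hf : Primrec f) : DecIn S fun a => ∀ b ∈ f a, P (a, b) := by
  refine hS.decIn_of_search hP hP (β := ℕ)
    (p := fun c => (f c.1).all fun b =>
      decide (c.2.2.1[Encodable.encode (c.1, b)]? = some true))
    (q := fun c => (f c.1).any fun b =>
      decide (c.2.2.1[Encodable.encode (c.1, b)]? = some false))
    (by fun_prop) (by fun_prop) ?_ ?_ ?_ ?_
  · intro a _ m h b hb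
    simp only [List.all_eq_true, decide_eq_true_eq] at h
    exact initSeg_charFun_true (h b hb)
  · intro a _ m h hc
    simp only [List.any_eq_true, decide_eq_true_eq] at h
    obtain ⟨b, hb, h⟩ := h
    exact initSeg_charFun_false h (hc b hb)
  · intro a ha
    obtain ⟨m, hm⟩ := exists_bound ((f a).map fun b => (a, b))
    refine ⟨0, m, ?_⟩
    simp only [List.all_eq_true, decide_eq_true_eq]
    exact fun b hb => initSeg_charFun_of (hm _ (List.mem_map_of_mem hb)) (ha b hb)
  · intro a ha
    push Not at ha
    obtain ⟨b, hb, h⟩ := ha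
    refine ⟨0, Encodable.encode (a, b) + 1, ?_⟩
    simp only [List.any_eq_true, decide_eq_true_eq]
    exact ⟨b, hb, initSeg_charFun_of_not (Nat.lt_succ_self _) h⟩

theorem exists_mem (hS : IsScottSet S) {P : α × β → Prop} (hP : DecIn S P) {f : α → List β}
    (hf : Primrec f) : DecIn S fun a => ∃ b ∈ f a, P (a, b) :=
  of_iff (((hP.not hS).forall_mem hS hf).not hS) fun a => by push Not; rfl

end DecIn

/-- Since `S` is closed downwards under Turing reducibility, being computable in an element of `S`
is the same as being an element of `S`. -/
theorem IsScottSet.computableInSome_iff (hS : IsScottSet S) {ι : Type} (code : ι → ℕ)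
    (A : Set ι) : ComputableInSome S code A ↔ DecIn S fun n : ℕ => n ∈ code '' A := by
  have : charFun (Encodable.encode '' {n : ℕ | n ∈ code '' A}) = charFun (code '' A) :=
    congrArg charFun (by ext n; simp)
  rw [DecIn, this]
  exact ⟨fun ⟨x, hx, h⟩ => hS.mem_of_le hx h, fun h => ⟨_, h, TuringReducible.refl _⟩⟩

end

noncomputable section

/-! ### Linear inequalities and Fourier–Motzkin elimination -/

/-- A linear inequality `∑ l < ∑ r` (strict) or `∑ l ≤ ∑ r`, given by the strictness flag and
the lists `l` and `r` of (codes of) variables. -/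
abbrev Ineq : Type := Bool × List ℕ × List ℕ

/-- The number of occurrences of `x` in `l`. -/
def cnt (x : ℕ) (l : List ℕ) : ℕ := (l.filter fun y => decide (y = x)).length

/-- The list `l` repeated `k` times. -/
def rep (k : ℕ) (l : List ℕ) : List ℕ := (List.range k).flatMap fun _ => l

/-- The negation of an inequality. -/
def Ineq.neg (e : Ineq) : Ineq := (!e.1, e.2.2, e.2.1)

/-- The positive combination of `e` and `f` from which the variable `x` cancels. -/
def Ineq.comb (x : ℕ) (e f : Ineq) : Ineq :=
  (e.1 || f.1,
    rep (cnt x f.2.1 - cnt x f.2.2) e.2.1 ++ rep (cnt x e.2.2 - cnt x e.2.1) f.2.1,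
    rep (cnt x f.2.1 - cnt x f.2.2) e.2.2 ++ rep (cnt x e.2.2 - cnt x e.2.1) f.2.2)

/-- Fourier–Motzkin elimination of the variable `x` from a conjunction of inequalities. -/
def elimVar (x : ℕ) (C : List Ineq) : List Ineq :=
  (C.filter fun e => decide (cnt x e.2.1 = cnt x e.2.2)) ++
    (C.filter fun e => decide (cnt x e.2.1 < cnt x e.2.2)).flatMap fun e =>
      (C.filter fun f => decide (cnt x f.2.2 < cnt x f.2.1)).map fun f => Ineq.comb x e f

/-- The negation of a formula in disjunctive normal form. -/
def dnfNeg (D : List (List Ineq)) : List (List Ineq) :=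
  D.foldr (fun C E => C.flatMap fun e => E.map fun F => e.neg :: F) [[]]

/-- Universal quantification over `x` of a formula in disjunctive normal form. -/
def dnfAll (x : ℕ) (D : List (List Ineq)) : List (List Ineq) :=
  dnfNeg ((dnfNeg D).map fun C => elimVar x C)

section Primrec

variable {α : Type} [Primcodable α]

@[fun_prop]
theorem primrec_cnt {f : α → ℕ} {g : α → List ℕ} (hf : Primrec f) (hg : Primrec g) :
    Primrec fun a => cnt (f a) (g a) := by
  unfold cnt; fun_prop

@[fun_prop]
theorem primrec_rep {f : α → ℕ} {g : α → List ℕ} (hf : Primrec f) (hg : Primrec g) :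
    Primrec fun a => rep (f a) (g a) := by
  unfold rep; fun_prop

@[fun_prop]
theorem primrec_neg {f : α → Ineq} (hf : Primrec f) : Primrec fun a => (f a).neg := by
  unfold Ineq.neg; fun_prop

@[fun_prop]
theorem primrec_comb {f : α → ℕ} {g h : α → Ineq} (hf : Primrec f) (hg : Primrec g)
    (hh : Primrec h) : Primrec fun a => Ineq.comb (f a) (g a) (h a) := by
  unfold Ineq.comb; fun_prop

@[fun_prop]
theorem primrec_elimVar {f : α → ℕ} {g : α → List Ineq} (hf : Primrec f) (hg : Primrec g) :
    Primrec fun a => elimVar (f a) (g a) := by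
  unfold elimVar; fun_prop

@[fun_prop]
theorem primrec_dnfNeg {f : α → List (List Ineq)} (hf : Primrec f) :
    Primrec fun a => dnfNeg (f a) := by
  unfold dnfNeg; fun_prop

@[fun_prop]
theorem primrec_dnfAll {f : α → ℕ} {g : α → List (List Ineq)} (hf : Primrec f) (hg : Primrec g) :
    Primrec fun a => dnfAll (f a) (g a) := by
  unfold dnfAll; fun_prop

end Primrec

/-! ### Values of formal sums of variables -/

section Sums

variable {G : Type} [AddCommGroup G]

/-- The value of a sum of variables. -/
def lsum (ρ : ℕ → G) (l : List ℕ) : G := (l.map ρ).sum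

theorem lsum_nil (ρ : ℕ → G) : lsum ρ [] = 0 := rfl

theorem lsum_cons (ρ : ℕ → G) (x : ℕ) (l : List ℕ) : lsum ρ (x :: l) = ρ x + lsum ρ l := by
  simp [lsum]

theorem lsum_append (ρ : ℕ → G) (l l' : List ℕ) : lsum ρ (l ++ l') = lsum ρ l + lsum ρ l' := by
  simp [lsum]

theorem lsum_rep (ρ : ℕ → G) (k : ℕ) (l : List ℕ) : lsum ρ (rep k l) = k • lsum ρ l := by
  induction k with
  | zero => simp [rep, lsum]
  | succ k ih =>
    rw [rep, List.range_succ, List.flatMap_append, ← rep, lsum_append, ih]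
    simp [add_smul]

/-- Isolates the contribution of the eliminated variable; setting it to zero leaves the part that
serves as a bound. -/
theorem lsum_update (ρ : ℕ → G) (x : ℕ) (g : G) (l : List ℕ) :
    lsum (Function.update ρ x g) l = cnt x l • g + lsum (Function.update ρ x 0) l := by
  induction l with
  | nil => simp [lsum, cnt]
  | cons y l ih =>
    rw [lsum_cons, lsum_cons, ih]
    by_cases h : y = x
    · subst h
      simp [cnt, add_smul]
      abel
    · simp [cnt, h]
      abel

end Sums

section Flag

variable {G : Type} [LinearOrder G]

/-- The relation `<` or `≤`, depending on a flag. -/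
def flagLT (s : Bool) (a b : G) : Prop := if s then a < b else a ≤ b

theorem flagLT_of_lt {s : Bool} {a b : G} (h : a < b) : flagLT s a b := by
  cases s <;> simp [flagLT, h, h.le]

theorem flagLT_le {s : Bool} {a b : G} (h : flagLT s a b) : a ≤ b := by
  cases s
  · simpa [flagLT] using h
  · exact le_of_lt (by simpa [flagLT] using h)

theorem flagLT_trans {s t : Bool} {a b c : G} (h : flagLT s a b) (h' : flagLT t b c) :
    flagLT (s || t) a c := by
  cases s <;> cases t <;> simp only [flagLT] at * <;> simp at * <;> order

end Flag

theorem cnt_rep (x c : ℕ) (l : List ℕ) : cnt x (rep c l) = c * cnt x l := by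
  induction c with
  | zero => simp [rep, cnt]
  | succ c ih =>
    rw [rep, List.range_succ, List.flatMap_append, ← rep, cnt, List.filter_append,
      List.length_append, ← cnt, ih]
    simp [cnt, add_mul]

theorem cnt_append (x : ℕ) (l l' : List ℕ) : cnt x (l ++ l') = cnt x l + cnt x l' := by
  simp [cnt]

/-! ### Correctness of Fourier–Motzkin elimination -/

section Semantics

variable {G : Type} [AddCommGroup G] [LinearOrder G]

/-- The truth of an inequality. -/
def Ineq.Holds (ρ : ℕ → G) (e : Ineq) : Prop :=
  if e.1 then lsum ρ e.2.1 < lsum ρ e.2.2 else lsum ρ e.2.1 ≤ lsum ρ e.2.2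

/-- The truth of a formula in disjunctive normal form. -/
def dnfHolds (ρ : ℕ → G) (D : List (List Ineq)) : Prop := ∃ C ∈ D, ∀ e ∈ C, e.Holds ρ

theorem Ineq.holds_neg (ρ : ℕ → G) (e : Ineq) : e.neg.Holds ρ ↔ ¬ e.Holds ρ := by
  rcases e with ⟨_ | _, l, r⟩ <;> simp [Ineq.neg, Ineq.Holds]

/-- By De Morgan, each clause must contain a failing inequality; `dnfNeg` enumerates the ways of
choosing one from every clause. The empty disjunction correctly becomes `[[]]`, the true formula. -/
theorem dnfHolds_neg (ρ : ℕ → G) (D : List (List Ineq)) :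
    dnfHolds ρ (dnfNeg D) ↔ ¬ dnfHolds ρ D := by
  induction D with
  | nil => simp [dnfHolds, dnfNeg]
  | cons C D ih =>
    have h1 : dnfHolds ρ (dnfNeg (C :: D)) ↔ (∃ e ∈ C, e.neg.Holds ρ) ∧ dnfHolds ρ (dnfNeg D) := by
      simp only [dnfHolds, dnfNeg, List.foldr_cons, List.mem_flatMap, List.mem_map]
      constructor
      · rintro ⟨_, ⟨e, he, F, hF, rfl⟩, h⟩
        simp only [List.mem_cons, forall_eq_or_imp] at h
        exact ⟨⟨e, he, h.1⟩, F, hF, h.2⟩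
      · rintro ⟨⟨e, he, h⟩, F, hF, h'⟩
        refine ⟨_, ⟨e, he, F, hF, rfl⟩, ?_⟩
        simp only [List.mem_cons, forall_eq_or_imp]
        exact ⟨h, h'⟩
    rw [h1, ih]
    simp only [dnfHolds, Ineq.holds_neg, List.mem_cons, exists_eq_or_imp, not_or, not_forall,
      exists_prop]

theorem dnfHolds_append (ρ : ℕ → G) (D E : List (List Ineq)) :
    dnfHolds ρ (D ++ E) ↔ dnfHolds ρ D ∨ dnfHolds ρ E := by
  simp [dnfHolds, or_and_right, exists_or]

/-- Compare the greatest lower bound in `L` with the least upper bound in `U`. If they differ,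
density gives a point strictly between; if they coincide, the pairwise conditions exclude a strict
bound at the common value, so that value works. Empty lists need the absence of endpoints. -/
theorem exists_between_flags [DenselyOrdered G] [NoMaxOrder G] [NoMinOrder G]
    (L U : List (Bool × G)) (h : ∀ e ∈ L, ∀ f ∈ U, flagLT (e.1 || f.1) e.2 f.2) :
    ∃ g : G, (∀ e ∈ L, flagLT e.1 e.2 g) ∧ ∀ f ∈ U, flagLT f.1 g f.2 := by
  have hmax : ∀ L : List (Bool × G), L ≠ [] → ∃ e ∈ L, ∀ f ∈ L, f.2 ≤ e.2 := fun L hL => by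
    simpa using L.toFinset.exists_max_image Prod.snd (by simpa using hL)
  have hmin : ∀ L : List (Bool × G), L ≠ [] → ∃ e ∈ L, ∀ f ∈ L, e.2 ≤ f.2 := fun L hL => by
    simpa using L.toFinset.exists_min_image Prod.snd (by simpa using hL)
  by_cases hL : L = []
  · by_cases hU : U = []
    · exact ⟨0, by simp [hL], by simp [hU]⟩
    · obtain ⟨u, -, hu⟩ := hmin U hU
      obtain ⟨g, hg⟩ := exists_lt u.2
      exact ⟨g, by simp [hL], fun f hf => flagLT_of_lt (hg.trans_le (hu f hf))⟩
  · obtain ⟨m, hm, hmm⟩ := hmax L hL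
    by_cases hU : U = []
    · obtain ⟨g, hg⟩ := exists_gt m.2
      exact ⟨g, fun e he => flagLT_of_lt ((hmm e he).trans_lt hg), by simp [hU]⟩
    · obtain ⟨u, hu, huu⟩ := hmin U hU
      rcases (flagLT_le (h m hm u hu)).lt_or_eq with hlt | heq
      · obtain ⟨g, h1, h2⟩ := exists_between hlt
        exact ⟨g, fun e he => flagLT_of_lt ((hmm e he).trans_lt h1),
          fun f hf => flagLT_of_lt (h2.trans_le (huu f hf))⟩
      · refine ⟨m.2, fun e he => ?_, fun f hf => ?_⟩
        · have := h e he u hu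
          rw [← heq] at this
          rcases e with ⟨_ | _, e⟩
          · exact hmm _ he
          · simpa [flagLT] using this
        · have := h m hm f hf
          rcases f with ⟨_ | _, f⟩
          · simpa [flagLT, heq] using huu _ hf
          · simpa [flagLT] using this

theorem flagLT_nsmul [IsOrderedAddMonoid G] {s : Bool} {a b : G} {k : ℕ} (hk : 0 < k) :
    flagLT s (k • a) (k • b) ↔ flagLT s a b := by
  have h : ∀ a b : G, k • a ≤ k • b ↔ a ≤ b := fun a b => nsmul_le_nsmul_iff_right hk.ne'
  cases s
  · exact h a b
  · simpa [flagLT] using not_congr (h b a)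

theorem flagLT_congr [IsOrderedAddMonoid G] {s : Bool} {a b c d : G} (h : b - a = d - c) :
    flagLT s a b ↔ flagLT s c d := by
  cases s
  · change a ≤ b ↔ c ≤ d
    rw [← sub_nonneg, h, sub_nonneg]
  · change a < b ↔ c < d
    rw [← sub_pos, h, sub_pos]

theorem Ineq.holds_iff_flagLT (ρ : ℕ → G) (e : Ineq) :
    e.Holds ρ ↔ flagLT e.1 (lsum ρ e.2.1) (lsum ρ e.2.2) := Iff.rfl

theorem Ineq.holds_update_of_cnt_eq [IsOrderedAddMonoid G] (ρ : ℕ → G) (x : ℕ) (g : G) (e : Ineq)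
    (he : cnt x e.2.1 = cnt x e.2.2) : e.Holds (Function.update ρ x g) ↔ e.Holds ρ := by
  rw [holds_iff_flagLT, holds_iff_flagLT]
  refine flagLT_congr ?_
  conv_rhs => rw [← Function.update_eq_self x ρ]
  rw [lsum_update, lsum_update _ _ g, lsum_update _ _ (ρ x), lsum_update _ _ (ρ x), he]
  abel

/-- With more occurrences of `x` on the right, collecting them and dividing by the excess gives a
lower bound for `x`. The equation for the multiple of `r` is kept to compare bounds and, later, to
locate `r` in a rational span. -/
theorem IsDivisibleOrderedAbelianGroup.holds_lower (hG : IsDivisibleOrderedAbelianGroup G)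
    (ρ : ℕ → G) (x : ℕ) (e : Ineq) (he : cnt x e.2.1 < cnt x e.2.2) :
    ∃ r : G, (cnt x e.2.2 - cnt x e.2.1) • r =
        lsum (Function.update ρ x 0) e.2.1 - lsum (Function.update ρ x 0) e.2.2 ∧
      ∀ g, e.Holds (Function.update ρ x g) ↔ flagLT e.1 r g := by
  have := hG.isOrdered
  obtain ⟨k, hk⟩ := Nat.exists_eq_add_of_lt he
  have hk' : cnt x e.2.2 - cnt x e.2.1 = k + 1 := by omega
  obtain ⟨r, hr⟩ := hG.divisible _ (k.succ_ne_zero)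
    (lsum (Function.update ρ x 0) e.2.1 - lsum (Function.update ρ x 0) e.2.2)
  refine ⟨r, by rw [hk', ← hr], fun g => ?_⟩
  rw [← flagLT_nsmul k.succ_pos, hr, Ineq.holds_iff_flagLT]
  refine flagLT_congr ?_
  rw [lsum_update, lsum_update _ _ g, hk, Nat.succ_eq_add_one, add_assoc, add_smul (cnt x e.2.1)]
  abel

theorem IsDivisibleOrderedAbelianGroup.holds_upper (hG : IsDivisibleOrderedAbelianGroup G)
    (ρ : ℕ → G) (x : ℕ) (e : Ineq) (he : cnt x e.2.2 < cnt x e.2.1) :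
    ∃ r : G, (cnt x e.2.1 - cnt x e.2.2) • r =
        lsum (Function.update ρ x 0) e.2.2 - lsum (Function.update ρ x 0) e.2.1 ∧
      ∀ g, e.Holds (Function.update ρ x g) ↔ flagLT e.1 g r := by
  have := hG.isOrdered
  obtain ⟨k, hk⟩ := Nat.exists_eq_add_of_lt he
  have hk' : cnt x e.2.1 - cnt x e.2.2 = k + 1 := by omega
  obtain ⟨r, hr⟩ := hG.divisible _ (k.succ_ne_zero)
    (lsum (Function.update ρ x 0) e.2.2 - lsum (Function.update ρ x 0) e.2.1)
  refine ⟨r, by rw [hk', ← hr], fun g => ?_⟩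
  rw [← flagLT_nsmul k.succ_pos, hr, Ineq.holds_iff_flagLT]
  refine flagLT_congr ?_
  rw [lsum_update, lsum_update _ _ g, hk, Nat.succ_eq_add_one, add_assoc, add_smul (cnt x e.2.2)]
  abel

/-- Density comes from midpoints, obtained by dividing `a + b` by two. -/
theorem IsDivisibleOrderedAbelianGroup.order_instances (hG : IsDivisibleOrderedAbelianGroup G) :
    DenselyOrdered G ∧ NoMaxOrder G ∧ NoMinOrder G := by
  have := hG.isOrdered
  have := hG.nontrivial
  refine ⟨⟨fun a b hab => ?_⟩, inferInstance, inferInstance⟩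
  obtain ⟨c, hc⟩ := hG.divisible 2 two_ne_zero (a + b)
  rw [two_nsmul] at hc
  refine ⟨c, lt_of_not_ge fun h => ?_, lt_of_not_ge fun h => ?_⟩
  · exact absurd hc (add_lt_add_of_le_of_lt h (h.trans_lt hab)).ne
  · exact absurd hc.symm (add_lt_add_of_lt_of_le (hab.trans_le h) h).ne

/-- The elimination step is correct in divisible ordered abelian groups. -/
theorem IsDivisibleOrderedAbelianGroup.elimVar_holds (hG : IsDivisibleOrderedAbelianGroup G)
    (ρ : ℕ → G) (x : ℕ) (C : List Ineq) :
    (∀ e ∈ elimVar x C, e.Holds ρ) ↔ ∃ g, ∀ e ∈ C, e.Holds (Function.update ρ x g) := by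
  have := hG.isOrdered
  obtain ⟨_, _, _⟩ := hG.order_instances
  have hlow := hG.holds_lower ρ x
  have hupp := hG.holds_upper ρ x
  choose! lo hlo hlo' using hlow
  choose! up hup hup' using hupp
  -- With excesses `c` and `d` of `x` in `e` and `f`, the combination compares `c * d` times the
  -- lower bound with `c * d` times the upper bound.
  have hcomb : ∀ e f : Ineq, cnt x e.2.1 < cnt x e.2.2 → cnt x f.2.2 < cnt x f.2.1 →
      ((Ineq.comb x e f).Holds ρ ↔ flagLT (e.1 || f.1) (lo e) (up f)) := by
    intro e f he hf
    obtain ⟨c, hc⟩ : ∃ c, cnt x e.2.2 - cnt x e.2.1 = c := ⟨_, rfl⟩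
    obtain ⟨d, hd⟩ : ∃ d, cnt x f.2.1 - cnt x f.2.2 = d := ⟨_, rfl⟩
    have hc' : cnt x e.2.2 = cnt x e.2.1 + c := by omega
    have hd' : cnt x f.2.1 = cnt x f.2.2 + d := by omega
    have h1 := hlo e he
    have h2 := hup f hf
    rw [hc] at h1
    rw [hd] at h2
    -- As `x` cancels in the combination, it may be set to zero, where the equations for `lo` and
    -- `up` apply.
    rw [← Ineq.holds_update_of_cnt_eq ρ x 0, Ineq.holds_iff_flagLT,
      ← flagLT_nsmul (a := lo e) (b := up f) (k := c * d) (Nat.mul_pos (by omega) (by omega))]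
    · refine flagLT_congr ?_
      simp only [Ineq.comb, hc, hd, lsum_append, lsum_rep]
      rw [mul_comm c d, mul_smul, mul_smul, h1, smul_comm, h2, smul_sub, smul_sub]
      abel
    · simp only [Ineq.comb, hc, hd, cnt_append, cnt_rep]
      rw [hc', hd']
      ring
  have hmem : (∀ e ∈ elimVar x C, e.Holds ρ) ↔
      (∀ e ∈ C, cnt x e.2.1 = cnt x e.2.2 → e.Holds ρ) ∧
      ∀ e ∈ C, cnt x e.2.1 < cnt x e.2.2 → ∀ f ∈ C, cnt x f.2.2 < cnt x f.2.1 →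
        flagLT (e.1 || f.1) (lo e) (up f) := by
    simp only [elimVar, List.mem_append, List.mem_filter, List.mem_flatMap, List.mem_map,
      decide_eq_true_eq]
    constructor
    · intro h
      exact ⟨fun e he h' => h e (.inl ⟨he, h'⟩), fun e he he' f hf hf' =>
        (hcomb e f he' hf').1 (h _ (.inr ⟨e, ⟨he, he'⟩, f, ⟨hf, hf'⟩, rfl⟩))⟩
    · rintro ⟨h, h'⟩ _ (⟨he, he'⟩ | ⟨e, ⟨he, he'⟩, f, ⟨hf, hf'⟩, rfl⟩)
      · exact h _ he he'
      · exact (hcomb e f he' hf').2 (h' e he he' f hf hf')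
  rw [hmem]
  constructor
  · rintro ⟨h1, h2⟩
    obtain ⟨g, hg1, hg2⟩ := exists_between_flags
      ((C.filter fun e => decide (cnt x e.2.1 < cnt x e.2.2)).map fun e => (e.1, lo e))
      ((C.filter fun f => decide (cnt x f.2.2 < cnt x f.2.1)).map fun f => (f.1, up f)) (by
        simp only [List.mem_map, List.mem_filter, decide_eq_true_eq]
        rintro _ ⟨e, ⟨he, he'⟩, rfl⟩ _ ⟨f, ⟨hf, hf'⟩, rfl⟩
        exact h2 e he he' f hf hf')
    simp only [List.mem_map, List.mem_filter, decide_eq_true_eq] at hg1 hg2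
    refine ⟨g, fun e he => ?_⟩
    rcases lt_trichotomy (cnt x e.2.1) (cnt x e.2.2) with h | h | h
    · exact (hlo' e h g).2 (hg1 _ ⟨e, ⟨he, h⟩, rfl⟩)
    · exact (Ineq.holds_update_of_cnt_eq ρ x g e h).2 (h1 e he h)
    · exact (hup' e h g).2 (hg2 _ ⟨e, ⟨he, h⟩, rfl⟩)
  · rintro ⟨g, hg⟩
    refine ⟨fun e he h => (Ineq.holds_update_of_cnt_eq ρ x g e h).1 (hg e he),
      fun e he h f hf h' => flagLT_trans ((hlo' e h g).1 (hg e he)) ((hup' f h' g).1 (hg f hf))⟩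

/-- Rewrite `∀` as `¬ ∃ ¬`; the existential quantifier distributes over the disjunction, so
elimination acts on each clause separately. -/
theorem IsDivisibleOrderedAbelianGroup.dnfHolds_all (hG : IsDivisibleOrderedAbelianGroup G)
    (ρ : ℕ → G) (x : ℕ) (D : List (List Ineq)) :
    dnfHolds ρ (dnfAll x D) ↔ ∀ g, dnfHolds (Function.update ρ x g) D := by
  rw [dnfAll, dnfHolds_neg]
  have : dnfHolds ρ ((dnfNeg D).map fun C => elimVar x C) ↔
      ∃ g, dnfHolds (Function.update ρ x g) (dnfNeg D) := by
    simp only [dnfHolds, List.mem_map, exists_exists_and_eq_and, hG.elimVar_holds]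
    exact ⟨fun ⟨C, hC, g, h⟩ => ⟨g, C, hC, h⟩, fun ⟨g, C, hC, h⟩ => ⟨C, hC, g, h⟩⟩
  rw [this]
  simp [dnfHolds_neg]

end Semantics

end

noncomputable section

/-! ### Quantifier elimination for formulas and for their codes -/

open FirstOrder.Language

/-- A term as a difference of two sums of variables: the pair `(l, r)` stands for `∑ r - ∑ l`. -/
def termForm {m n : ℕ} : og.Term (Fin m ⊕ Fin n) → List ℕ × List ℕ
  | .var a => ([], [varCode a])
  | .func OGFunc.zero _ => ([], [])
  | .func OGFunc.neg t => ((termForm (t 0)).2, (termForm (t 0)).1)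
  | .func OGFunc.add t => ((termForm (t 0)).1 ++ (termForm (t 1)).1,
      (termForm (t 0)).2 ++ (termForm (t 1)).2)

/-- The inequality between two differences of sums. -/
def formIneq (s : Bool) (a b : List ℕ × List ℕ) : Ineq := (s, a.2 ++ b.1, b.2 ++ a.1)

/-- A quantifier-free equivalent, in disjunctive normal form, of a formula. -/
def formDNF {m : ℕ} : {n : ℕ} → og.BoundedFormula (Fin m) n → List (List Ineq)
  | _, .falsum => []
  | _, .equal t u =>
      [[formIneq false (termForm t) (termForm u), formIneq false (termForm u) (termForm t)]]
  | _, .rel OGRel.lt t => [[formIneq true (termForm (t 0)) (termForm (t 1))]]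
  | _, .imp φ ψ => dnfNeg (formDNF φ) ++ formDNF ψ
  | n, .all φ => dnfAll (2 * n + 1) (formDNF φ)

section Semantics

variable {G : Type} [AddCommGroup G] [LinearOrder G]

theorem realize_termForm {m n : ℕ} {v : Fin m → G} {xs : Fin n → G} {ρ : ℕ → G}
    (hρ : ∀ a, ρ (varCode a) = Sum.elim v xs a) (t : og.Term (Fin m ⊕ Fin n)) :
    t.realize (Sum.elim v xs) = lsum ρ (termForm t).2 - lsum ρ (termForm t).1 := by
  induction t with
  | var a => simp [termForm, lsum, hρ]
  | func f t ih =>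
    cases f with
    | zero => simp only [termForm, lsum_nil, sub_zero]; rfl
    | neg =>
      simp only [termForm]
      rw [← neg_sub, ← ih 0]
      rfl
    | add =>
      simp only [termForm, lsum_append]
      rw [add_sub_add_comm, ← ih 0, ← ih 1]
      rfl

theorem formIneq_holds [IsOrderedAddMonoid G] (ρ : ℕ → G) (s : Bool) (a b : List ℕ × List ℕ) :
    (formIneq s a b).Holds ρ ↔
      flagLT s (lsum ρ a.2 - lsum ρ a.1) (lsum ρ b.2 - lsum ρ b.1) := by
  rw [Ineq.holds_iff_flagLT]
  refine flagLT_congr ?_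
  simp only [formIneq, lsum_append]
  abel

/-- Quantifier elimination for divisible ordered abelian groups. -/
theorem IsDivisibleOrderedAbelianGroup.realize_iff (hG : IsDivisibleOrderedAbelianGroup G)
    {m n : ℕ} (φ : og.BoundedFormula (Fin m) n) {v : Fin m → G} {xs : Fin n → G} {ρ : ℕ → G}
    (hρ : ∀ a, ρ (varCode a) = Sum.elim v xs a) :
    φ.Realize v xs ↔ dnfHolds ρ (formDNF φ) := by
  have := hG.isOrdered
  induction φ generalizing ρ with
  | falsum => simp [formDNF, dnfHolds, BoundedFormula.Realize]
  | equal t u =>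
    simp only [formDNF, dnfHolds, exists_eq_left, List.mem_cons,
      List.not_mem_nil, or_false, forall_eq_or_imp, forall_eq, formIneq_holds,
      ← realize_termForm hρ]
    exact le_antisymm_iff
  | rel R t =>
    cases R
    simp only [formDNF, dnfHolds, List.mem_singleton, exists_eq_left, forall_eq, formIneq_holds,
      ← realize_termForm hρ]
    rfl
  | imp φ ψ ih1 ih2 =>
    rw [formDNF, dnfHolds_append, dnfHolds_neg, BoundedFormula.realize_imp]
    exact (imp_congr (ih1 hρ) (ih2 hρ)).trans imp_iff_not_or
  | @all n φ ih =>
    rw [formDNF, hG.dnfHolds_all, BoundedFormula.realize_all]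
    -- The newly bound variable has code `2 * n + 1`, different from the even codes of free
    -- variables and the smaller odd codes of earlier bound ones, so the update disturbs no other
    -- value.
    refine forall_congr' fun g => ih fun a => ?_
    rcases a with i | j
    · rw [Function.update_of_ne (by simp [varCode]; omega)]
      exact hρ (.inl i)
    · refine Fin.lastCases ?_ (fun j => ?_) j
      · simp [varCode]
      · rw [Function.update_of_ne (by simp [varCode]; omega)]
        simpa [varCode] using hρ (.inr j)

end Semantics

/-- Codes of subterms are smaller. -/
theorem unpair_lt {c : ℕ} (h : c.unpair.1 ≠ 0) : c.unpair.2 < c := by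
  have := Nat.add_le_pair c.unpair.1 c.unpair.2
  rw [Nat.pair_unpair] at this
  omega

/-- Validity of the code of a variable. -/
def varValid (m n v : ℕ) : Bool :=
  (decide (v % 2 = 0) && decide (v / 2 < m)) || (decide (v % 2 = 1) && decide (v / 2 < n))

theorem varValid_iff {m n v : ℕ} : varValid m n v ↔ ∃ a : Fin m ⊕ Fin n, varCode a = v := by
  simp only [varValid, Bool.or_eq_true, Bool.and_eq_true, decide_eq_true_eq]
  constructor
  · rintro (⟨h, h'⟩ | ⟨h, h'⟩)
    · exact ⟨.inl ⟨_, h'⟩, by simp only [varCode]; omega⟩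
    · exact ⟨.inr ⟨_, h'⟩, by simp only [varCode]; omega⟩
  · rintro ⟨i | j, rfl⟩
    · exact .inl ⟨by simp [varCode], by simp [varCode]⟩
    · refine .inr ⟨by simp only [varCode]; omega, ?_⟩
      have : (2 * (j : ℕ) + 1) / 2 = j := by omega
      simp [varCode, this]

/-- The computation of `termForm` from the code of the term. -/
def termDecode (m n c : ℕ) : Option (List ℕ × List ℕ) :=
  if c.unpair.1 = 0 then (if varValid m n c.unpair.2 then some ([], [c.unpair.2]) else none)
  else if c.unpair.1 = 1 then (if c.unpair.2 = 0 then some ([], []) else none)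
  else if _h : c.unpair.1 = 2 then (termDecode m n c.unpair.2).map fun a => (a.2, a.1)
  else if _h : c.unpair.1 = 3 then
    (termDecode m n c.unpair.2.unpair.1).bind fun a =>
      (termDecode m n c.unpair.2.unpair.2).map fun b => (a.1 ++ b.1, a.2 ++ b.2)
  else none
termination_by c
decreasing_by
  · exact unpair_lt (by omega)
  · exact (Nat.unpair_left_le _).trans_lt (unpair_lt (by omega))
  · exact (Nat.unpair_right_le _).trans_lt (unpair_lt (by omega))

theorem termDecode_termCode {m n : ℕ} (t : og.Term (Fin m ⊕ Fin n)) :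
    termDecode m n (termCode varCode t) = some (termForm t) := by
  induction t with
  | var a =>
    rw [termDecode]
    simp [termCode, termForm, varValid_iff]
  | func f t ih =>
    cases f with
    | zero => rw [termDecode]; simp [termCode, termForm]
    | neg => rw [termDecode]; simp [termCode, termForm, ih]
    | add => rw [termDecode]; simp [termCode, termForm, ih]

/-- The decoder succeeds only on genuine codes, so numbers that code no term are recognized
effectively. -/
theorem exists_term_of_termDecode {m n c : ℕ} (h : (termDecode m n c).isSome) :
    ∃ t : og.Term (Fin m ⊕ Fin n), termCode varCode t = c := by
  induction c using Nat.strong_induction_on with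
  | _ c ih =>
    have key : c = Nat.pair c.unpair.1 c.unpair.2 := (Nat.pair_unpair c).symm
    rw [termDecode] at h
    split_ifs at h with h0 hv h1 hz h2 h3
    · obtain ⟨a, ha⟩ := varValid_iff.1 hv
      exact ⟨.var a, by rw [termCode, ha, ← h0, ← key]⟩
    · simp at h
    · exact ⟨.func OGFunc.zero Fin.elim0, by rw [termCode, ← h1, ← hz, ← key]⟩
    · simp at h
    · obtain ⟨t, ht⟩ := ih _ (unpair_lt (by omega)) (by simpa using h)
      exact ⟨.func OGFunc.neg fun _ => t, by rw [termCode, ht, ← h2, ← key]⟩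
    · rcases ha : termDecode m n c.unpair.2.unpair.1 with _ | a
      · simp [ha] at h
      rcases hb : termDecode m n c.unpair.2.unpair.2 with _ | b
      · simp [ha, hb] at h
      obtain ⟨t, ht⟩ := ih _ ((Nat.unpair_left_le _).trans_lt (unpair_lt (by omega)))
        (by rw [ha]; rfl)
      obtain ⟨u, hu⟩ := ih _ ((Nat.unpair_right_le _).trans_lt (unpair_lt (by omega)))
        (by rw [hb]; rfl)
      refine ⟨.func OGFunc.add fun i => if i = 0 then t else u, ?_⟩
      rw [termCode, if_pos rfl, if_neg (by decide), ht, hu, Nat.pair_unpair, ← h3, ← key]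
    · simp at h

/-- Course-of-values recursion: `L` lists the values at all smaller codes, so its length is the
current code. -/
theorem primrec_termDecode : Primrec fun a : (ℕ × ℕ) × ℕ => termDecode a.1.1 a.1.2 a.2 := by
  have hv : ∀ {α : Type} [Primcodable α] {f g h : α → ℕ}, Primrec f → Primrec g → Primrec h →
      Primrec fun a => varValid (f a) (g a) (h a) := by
    intro α _ f g h hf hg hh
    unfold varValid; fun_prop
  refine Primrec.nat_strong_rec (fun (a : ℕ × ℕ) c => termDecode a.1 a.2 c)
    (g := fun a L => some <|
      bif decide (L.length.unpair.1 = 0) then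
        (bif varValid a.1 a.2 L.length.unpair.2 then some ([], [L.length.unpair.2]) else none)
      else bif decide (L.length.unpair.1 = 1) then
        (bif decide (L.length.unpair.2 = 0) then some ([], []) else none)
      else bif decide (L.length.unpair.1 = 2) then
        (L.getD L.length.unpair.2 none).map fun a => (a.2, a.1)
      else bif decide (L.length.unpair.1 = 3) then
        (L.getD L.length.unpair.2.unpair.1 none).bind fun a =>
          (L.getD L.length.unpair.2.unpair.2 none).map fun b => (a.1 ++ b.1, a.2 ++ b.2)
      else none) ?_ ?_
  · unfold Primrec₂
    fun_prop
  · intro a c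
    have hget : ∀ k < c, ((List.range c).map fun c => termDecode a.1 a.2 c).getD k none =
        termDecode a.1 a.2 k := fun k hk => by simp [List.getD, hk]
    simp only [List.length_map, List.length_range, Option.some.injEq, Bool.cond_eq_ite,
      decide_eq_true_eq]
    conv_rhs => rw [termDecode]
    split_ifs with h0 hv h1 hz h2 h3
    · rfl
    · rfl
    · rfl
    · rfl
    · rw [hget _ (unpair_lt (by omega))]
    · rw [hget _ ((Nat.unpair_left_le _).trans_lt (unpair_lt (by omega))),
        hget _ ((Nat.unpair_right_le _).trans_lt (unpair_lt (by omega)))]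
    · rfl

/-- The computation of `formDNF` from the code of the formula. -/
def formDecode (m n c : ℕ) : Option (List (List Ineq)) :=
  if c.unpair.1 = 0 then (if c.unpair.2 = 0 then some [] else none)
  else if c.unpair.1 = 1 then
    (termDecode m n c.unpair.2.unpair.1).bind fun a =>
      (termDecode m n c.unpair.2.unpair.2).map fun b =>
        [[formIneq false a b, formIneq false b a]]
  else if c.unpair.1 = 2 then
    (termDecode m n c.unpair.2.unpair.1).bind fun a =>
      (termDecode m n c.unpair.2.unpair.2).map fun b => [[formIneq true a b]]
  else if _h : c.unpair.1 = 3 then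
    (formDecode m n c.unpair.2.unpair.1).bind fun a =>
      (formDecode m n c.unpair.2.unpair.2).map fun b => dnfNeg a ++ b
  else if _h : c.unpair.1 = 4 then
    (formDecode m (n + 1) c.unpair.2).map fun a => dnfAll (2 * n + 1) a
  else none
termination_by c
decreasing_by
  · exact (Nat.unpair_left_le _).trans_lt (unpair_lt (by omega))
  · exact (Nat.unpair_right_le _).trans_lt (unpair_lt (by omega))
  · exact unpair_lt (by omega)

/-- Besides giving the algorithm, this shows that formulas with equal codes have equal normal forms
and are therefore equivalent, which replaces injectivity of the coding later. -/
theorem formDecode_formulaCode {m n : ℕ} (φ : og.BoundedFormula (Fin m) n) :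
    formDecode m n (formulaCode φ) = some (formDNF φ) := by
  induction φ with
  | falsum => rw [formDecode]; simp [formulaCode, formDNF]
  | equal t u => rw [formDecode]; simp [formulaCode, formDNF, termDecode_termCode]
  | rel R t =>
    cases R
    rw [formDecode]
    simp [formulaCode, formDNF, termDecode_termCode]
  | imp φ ψ ih1 ih2 => rw [formDecode]; simp [formulaCode, formDNF, ih1, ih2]
  | all φ ih => rw [formDecode]; simp [formulaCode, formDNF, ih]

theorem exists_formula_of_formDecode {m n c : ℕ} (h : (formDecode m n c).isSome) :
    ∃ φ : og.BoundedFormula (Fin m) n, formulaCode φ = c := by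
  induction c using Nat.strong_induction_on generalizing n with
  | _ c ih =>
    have key : c = Nat.pair c.unpair.1 c.unpair.2 := (Nat.pair_unpair c).symm
    have hterm : ((termDecode m n c.unpair.2.unpair.1).isSome ∧
        (termDecode m n c.unpair.2.unpair.2).isSome) →
        ∃ t u : og.Term (Fin m ⊕ Fin n),
          Nat.pair (termCode varCode t) (termCode varCode u) = c.unpair.2 := by
      rintro ⟨ha, hb⟩
      obtain ⟨t, ht⟩ := exists_term_of_termDecode ha
      obtain ⟨u, hu⟩ := exists_term_of_termDecode hb
      exact ⟨t, u, by rw [ht, hu, Nat.pair_unpair]⟩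
    rw [formDecode] at h
    split_ifs at h with h0 hz h1 h2 h3 h4
    · exact ⟨.falsum, by rw [formulaCode, ← h0]; nth_rw 2 [← hz.trans h0.symm]; rw [← key]⟩
    · simp at h
    · obtain ⟨t, u, htu⟩ := hterm (by
        rcases ha : termDecode m n c.unpair.2.unpair.1 with _ | a
        · simp [ha] at h
        · simpa [ha] using h)
      exact ⟨.equal t u, by rw [formulaCode, htu, ← h1, ← key]⟩
    · obtain ⟨t, u, htu⟩ := hterm (by
        rcases ha : termDecode m n c.unpair.2.unpair.1 with _ | a
        · simp [ha] at h
        · simpa [ha] using h)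
      exact ⟨.rel OGRel.lt fun i => if i = 0 then t else u, by
        rw [formulaCode, if_pos rfl, if_neg (by decide), htu, ← h2, ← key]⟩
    · rcases ha : formDecode m n c.unpair.2.unpair.1 with _ | a
      · simp [ha] at h
      rcases hb : formDecode m n c.unpair.2.unpair.2 with _ | b
      · simp [ha, hb] at h
      obtain ⟨φ, hφ⟩ := ih _ ((Nat.unpair_left_le _).trans_lt (unpair_lt (by omega)))
        (n := n) (by rw [ha]; rfl)
      obtain ⟨ψ, hψ⟩ := ih _ ((Nat.unpair_right_le _).trans_lt (unpair_lt (by omega)))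
        (n := n) (by rw [hb]; rfl)
      exact ⟨.imp φ ψ, by rw [formulaCode, hφ, hψ, Nat.pair_unpair, ← h3, ← key]⟩
    · obtain ⟨φ, hφ⟩ := ih _ (unpair_lt (by omega)) (n := n + 1) (by simpa using h)
      exact ⟨.all φ, by rw [formulaCode, hφ, ← h4, ← key]⟩
    · simp at h

/-- The number of bound variables grows under a quantifier, so the recursion has no fixed parameter.
It runs on whole triples, with the code as decreasing measure and `l` listing the recursive calls.
-/
theorem primrec_formDecode : Primrec fun b : ℕ × ℕ × ℕ => formDecode b.1 b.2.1 b.2.2 := by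
  have ht : ∀ {α : Type} [Primcodable α] {f g h : α → ℕ}, Primrec f → Primrec g → Primrec h →
      Primrec fun a => termDecode (f a) (g a) (h a) := fun hf hg hh =>
    primrec_termDecode.comp (.pair (.pair hf hg) hh)
  have hi : ∀ {α : Type} [Primcodable α] {s : Bool} {f g : α → List ℕ × List ℕ}, Primrec f →
      Primrec g → Primrec fun a => formIneq s (f a) (g a) := by
    intro α _ s f g hf hg
    unfold formIneq; fun_prop
  refine Primrec.nat_omega_rec' (fun b : ℕ × ℕ × ℕ => formDecode b.1 b.2.1 b.2.2)
    (m := fun b => b.2.2)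
    (l := fun b => bif decide (b.2.2.unpair.1 = 3) then
        [(b.1, b.2.1, b.2.2.unpair.2.unpair.1), (b.1, b.2.1, b.2.2.unpair.2.unpair.2)]
      else bif decide (b.2.2.unpair.1 = 4) then [(b.1, b.2.1 + 1, b.2.2.unpair.2)] else [])
    (g := fun b L => some <|
      bif decide (b.2.2.unpair.1 = 0) then
        (bif decide (b.2.2.unpair.2 = 0) then some [] else none)
      else bif decide (b.2.2.unpair.1 = 1) then
        (termDecode b.1 b.2.1 b.2.2.unpair.2.unpair.1).bind fun a =>
          (termDecode b.1 b.2.1 b.2.2.unpair.2.unpair.2).map fun d =>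
            [[formIneq false a d, formIneq false d a]]
      else bif decide (b.2.2.unpair.1 = 2) then
        (termDecode b.1 b.2.1 b.2.2.unpair.2.unpair.1).bind fun a =>
          (termDecode b.1 b.2.1 b.2.2.unpair.2.unpair.2).map fun d => [[formIneq true a d]]
      else bif decide (b.2.2.unpair.1 = 3) then
        (L.getD 0 none).bind fun a => (L.getD 1 none).map fun d => dnfNeg a ++ d
      else bif decide (b.2.2.unpair.1 = 4) then
        (L.getD 0 none).map fun a => dnfAll (2 * b.2.1 + 1) a
      else none) (by fun_prop) (by fun_prop) ?_ ?_ ?_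
  · unfold Primrec₂
    fun_prop (disch := assumption)
  · intro b b' hb'
    simp only [Bool.cond_eq_ite, decide_eq_true_eq] at hb'
    split_ifs at hb' with h3 h4
    · simp only [List.mem_cons, List.not_mem_nil, or_false] at hb'
      rcases hb' with rfl | rfl
      · exact (Nat.unpair_left_le _).trans_lt (unpair_lt (by omega))
      · exact (Nat.unpair_right_le _).trans_lt (unpair_lt (by omega))
    · simp only [List.mem_cons, List.not_mem_nil, or_false] at hb'
      subst hb'
      exact unpair_lt (by omega)
    · simp at hb'
  · rintro ⟨m, n, c⟩
    simp only [Bool.cond_eq_ite, decide_eq_true_eq, Option.some.injEq]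
    conv_rhs => rw [formDecode]
    split_ifs <;> rfl

end

noncomputable section

/-! ### Computation with rational numbers -/

/-- The rational number `(a - b) / (d + 1)` named by the triple `(a, b, d)`. -/
def ratVal (t : ℕ × ℕ × ℕ) : ℚ := ((t.1 : ℚ) - t.2.1) / (t.2.2 + 1)

theorem ratVal_surjective : Function.Surjective ratVal := by
  intro q
  refine ⟨(q.num.toNat, (-q.num).toNat, q.den - 1), ?_⟩
  have h1 : ((q.den - 1 : ℕ) : ℚ) + 1 = q.den := by
    have := q.den_pos
    rw [← Nat.cast_succ]
    congr 1
    omega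
  have h2 : ((q.num.toNat : ℕ) : ℚ) - ((-q.num).toNat : ℕ) = q.num := by
    have : ((q.num.toNat : ℕ) : ℤ) - ((-q.num).toNat : ℕ) = q.num := by omega
    exact_mod_cast this
  rw [ratVal, h1, h2, Rat.num_div_den]

/-- Comparison of named rational numbers. -/
def ratLT (s t : ℕ × ℕ × ℕ) : Bool :=
  decide (s.1 * (t.2.2 + 1) + t.2.1 * (s.2.2 + 1) < t.1 * (s.2.2 + 1) + s.2.1 * (t.2.2 + 1))

theorem ratLT_iff {s t : ℕ × ℕ × ℕ} : ratLT s t = true ↔ ratVal s < ratVal t := by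
  rw [ratLT, decide_eq_true_eq, ratVal, ratVal, div_lt_div_iff₀ (by positivity) (by positivity),
    ← Nat.cast_lt (α := ℚ)]
  push_cast
  constructor <;> intro h <;> linarith

/-- Addition of named rational numbers. -/
def ratAdd (s t : ℕ × ℕ × ℕ) : ℕ × ℕ × ℕ :=
  (s.1 * (t.2.2 + 1) + t.1 * (s.2.2 + 1), s.2.1 * (t.2.2 + 1) + t.2.1 * (s.2.2 + 1),
    s.2.2 * t.2.2 + s.2.2 + t.2.2)

theorem ratVal_add (s t : ℕ × ℕ × ℕ) : ratVal (ratAdd s t) = ratVal s + ratVal t := by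
  simp only [ratVal, ratAdd]
  push_cast
  have h1 : ((s.2.2 : ℚ) + 1) ≠ 0 := by positivity
  have h2 : ((t.2.2 : ℚ) + 1) ≠ 0 := by positivity
  -- The third component stores the denominator minus one, so the stored value is the product of the
  -- denominators minus one.
  have h3 : ((s.2.2 : ℚ) * t.2.2 + s.2.2 + t.2.2 + 1) = (s.2.2 + 1) * (t.2.2 + 1) := by ring
  rw [h3]
  field_simp
  ring

/-- Multiplication of named rational numbers. -/
def ratMul (s t : ℕ × ℕ × ℕ) : ℕ × ℕ × ℕ :=
  (s.1 * t.1 + s.2.1 * t.2.1, s.1 * t.2.1 + s.2.1 * t.1, s.2.2 * t.2.2 + s.2.2 + t.2.2)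

theorem ratVal_mul (s t : ℕ × ℕ × ℕ) : ratVal (ratMul s t) = ratVal s * ratVal t := by
  simp only [ratVal, ratMul]
  push_cast
  have h1 : ((s.2.2 : ℚ) + 1) ≠ 0 := by positivity
  have h2 : ((t.2.2 : ℚ) + 1) ≠ 0 := by positivity
  have h3 : ((s.2.2 : ℚ) * t.2.2 + s.2.2 + t.2.2 + 1) = (s.2.2 + 1) * (t.2.2 + 1) := by ring
  rw [h3]
  field_simp
  ring

section Primrec

variable {α : Type} [Primcodable α] {f g : α → ℕ × ℕ × ℕ}

@[fun_prop]
theorem primrec_ratLT (hf : Primrec f) (hg : Primrec g) : Primrec fun a => ratLT (f a) (g a) := by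
  unfold ratLT; fun_prop

@[fun_prop]
theorem primrec_ratAdd (hf : Primrec f) (hg : Primrec g) :
    Primrec fun a => ratAdd (f a) (g a) := by
  unfold ratAdd; fun_prop

@[fun_prop]
theorem primrec_ratMul (hf : Primrec f) (hg : Primrec g) :
    Primrec fun a => ratMul (f a) (g a) := by
  unfold ratMul; fun_prop

end Primrec

theorem ratVal_def (t : ℕ × ℕ × ℕ) : ratVal t = ((t.1 : ℚ) - t.2.1) / (t.2.2 + 1) := rfl

theorem ratVal_zero : ratVal (0, 0, 0) = 0 := by simp [ratVal]

theorem ratVal_one : ratVal (1, 0, 0) = 1 := by simp [ratVal]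

attribute [irreducible] ratVal ratLT ratAdd ratMul

/-- The triple naming the rational number with a given code. -/
def ratName (n : ℕ) : ℕ × ℕ × ℕ :=
  (bif decide (n.unpair.1 % 2 = 0) then n.unpair.1 / 2 else 0,
    bif decide (n.unpair.1 % 2 = 0) then 0 else n.unpair.1 / 2 + 1, n.unpair.2 - 1)

/-- Validity of a code of a rational number. -/
def ratValid (n : ℕ) : Bool :=
  !decide (n.unpair.2 = 0) && (List.range (n.unpair.2 + 1)).all fun k =>
    decide (k = 1) || (!decide (((ratName n).1 + (ratName n).2.1) % k = 0) ||
      !decide (n.unpair.2 % k = 0))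

theorem encode_int_ofNat (a : ℕ) : Encodable.encode (Int.ofNat a) = 2 * a := rfl

theorem encode_int_negSucc (a : ℕ) : Encodable.encode (Int.negSucc a) = 2 * a + 1 := rfl

theorem ratName_encode (z : ℤ) (d : ℕ) :
    (ratName (Nat.pair (Encodable.encode z) d)).1 = z.toNat ∧
      (ratName (Nat.pair (Encodable.encode z) d)).2.1 = (-z).toNat := by
  rcases z with a | a
  · have h : Encodable.encode (a : ℤ) = 2 * a := encode_int_ofNat a
    simp [ratName, h]
  · simp only [ratName, encode_int_negSucc, Nat.unpair_pair]
    have h1 : (2 * a + 1) % 2 = 1 := by omega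
    have h2 : (2 * a + 1) / 2 = a := by omega
    rw [h1, h2]
    simp

theorem ratVal_ratName_ratCode (q : ℚ) : ratVal (ratName (ratCode q)) = q := by
  have h1 : (((ratName (ratCode q)).2.2 : ℕ) : ℚ) + 1 = q.den := by
    have := q.den_pos
    rw [← Nat.cast_succ]
    congr 1
    simp only [ratName, ratCode, Nat.unpair_pair]
    omega
  have h2 : ((q.num.toNat : ℕ) : ℚ) - ((-q.num).toNat : ℕ) = q.num := by
    have : ((q.num.toNat : ℕ) : ℤ) - ((-q.num).toNat : ℕ) = q.num := by omega
    exact_mod_cast this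
  rw [ratVal_def, h1, ratCode, (ratName_encode _ _).1, (ratName_encode _ _).2, h2, Rat.num_div_den]

/-- A code must have a nonzero denominator coprime to the numerator; coprimality is tested on all
possible common divisors up to the denominator. The candidate `k = 0` is harmless, since reduction
modulo zero leaves the nonzero denominator. -/
theorem ratValid_iff (n : ℕ) : ratValid n = true ↔ ∃ q, ratCode q = n := by
  have hcop : ∀ a b : ℕ, b ≠ 0 → (Nat.Coprime a b ↔
      ∀ k < b + 1, k = 1 ∨ (¬ a % k = 0 ∨ ¬ b % k = 0)) := by
    intro a b hb
    constructor
    · intro h k _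
      by_contra hc
      push Not at hc
      exact hc.1 (Nat.eq_one_of_dvd_coprimes h (Nat.dvd_of_mod_eq_zero hc.2.1)
        (Nat.dvd_of_mod_eq_zero hc.2.2))
    · intro h
      have h1 := Nat.le_of_dvd (Nat.pos_of_ne_zero hb) (Nat.gcd_dvd_right a b)
      rcases h (Nat.gcd a b) (by omega) with h | h | h
      · exact h
      · exact absurd (Nat.mod_eq_zero_of_dvd (Nat.gcd_dvd_left a b)) h
      · exact absurd (Nat.mod_eq_zero_of_dvd (Nat.gcd_dvd_right a b)) h
  have habs : ∀ (z : ℤ) (d : ℕ), (ratName (Nat.pair (Encodable.encode z) d)).1 +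
      (ratName (Nat.pair (Encodable.encode z) d)).2.1 = z.natAbs := by
    intro z d
    rw [(ratName_encode _ _).1, (ratName_encode _ _).2]
    omega
  simp only [ratValid, Bool.and_eq_true, List.all_eq_true, List.mem_range, Bool.or_eq_true,
    Bool.not_eq_true', decide_eq_true_eq, decide_eq_false_iff_not]
  constructor
  · rintro ⟨h0, h⟩
    obtain ⟨z, hz⟩ : ∃ z : ℤ, Encodable.encode z = n.unpair.1 :=
      ⟨Denumerable.ofNat ℤ n.unpair.1, Denumerable.encode_ofNat _⟩
    have hn : n = Nat.pair (Encodable.encode z) n.unpair.2 := by rw [hz, Nat.pair_unpair]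
    rw [← hcop _ _ h0, hn, habs, ← hn] at h
    exact ⟨⟨z, n.unpair.2, h0, h⟩, hn.symm⟩
  · rintro ⟨q, rfl⟩
    rw [← hcop]
    · rw [ratCode, habs, Nat.unpair_pair]
      exact ⟨q.den_nz, q.reduced⟩
    · simp [ratCode]

theorem primrec_ratName : Primrec ratName := by
  unfold ratName; fun_prop

theorem primrec_ratValid : Primrec ratValid := by
  have := @primrec_ratName
  unfold ratValid; fun_prop

/-! ### The field of reals computable in an element of a Scott set -/

variable {S : Set (ℕ → Bool)}

/-- Replaces codes in lowest terms by arbitrary triples, for which arithmetic is simpler. A triple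
is matched to its code by searching for a valid code of equal value; both answers are found this
way, so the new cut is decidable. -/
theorem IsScottSet.mem_realsOf_iff (hS : IsScottSet S) {r : ℝ} :
    r ∈ realsOf S ↔ DecIn S fun t => (ratVal t : ℝ) < r := by
  have hname := primrec_ratName
  have hvalid := primrec_ratValid
  change ComputableInSome S ratCode {q : ℚ | (q : ℝ) < r} ↔ _
  rw [hS.computableInSome_iff]
  have heq : DecIn S fun p : (ℕ × ℕ × ℕ) × ℕ =>
      (!ratLT p.1 (ratName p.2) && !ratLT (ratName p.2) p.1) = true :=
    hS.decIn_primrec (by fun_prop)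
  have heq' : ∀ (t : ℕ × ℕ × ℕ) (n : ℕ), (!ratLT t (ratName n) && !ratLT (ratName n) t) = true ↔
      ratVal t = ratVal (ratName n) := by
    intro t n
    rw [Bool.and_eq_true, Bool.not_eq_true', Bool.not_eq_true', ← Bool.not_eq_true,
      ← Bool.not_eq_true, ratLT_iff, ratLT_iff, not_lt, not_lt, and_comm, le_antisymm_iff]
  constructor
  · intro h
    have hc : DecIn S fun p : (ℕ × ℕ × ℕ) × ℕ => p.2 ∈ ratCode '' {q : ℚ | (q : ℝ) < r} :=
      h.comp hS Primrec.snd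
    have hv : DecIn S fun p : (ℕ × ℕ × ℕ) × ℕ => ratValid p.2 = true :=
      hS.decIn_primrec (by fun_prop)
    refine DecIn.delta hS (hc.and hS heq) (((hc.not hS).and hS hv).and hS heq) ?_ ?_
    · intro t
      simp only [heq']
      constructor
      · intro ht
        exact ⟨ratCode (ratVal t), ⟨_, ht, rfl⟩, (ratVal_ratName_ratCode _).symm⟩
      · rintro ⟨_, ⟨q, hq, rfl⟩, h⟩
        rwa [h, ratVal_ratName_ratCode]
    · intro t
      simp only [heq', ratValid_iff]
      constructor
      · intro ht
        refine ⟨ratCode (ratVal t), ⟨?_, _, rfl⟩, (ratVal_ratName_ratCode _).symm⟩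
        rintro ⟨q, hq, hqt⟩
        have := congrArg (fun n => ratVal (ratName n)) hqt
        simp only [ratVal_ratName_ratCode] at this
        exact ht (this ▸ hq)
      · rintro ⟨_, ⟨hn, q, rfl⟩, h⟩ ht
        rw [ratVal_ratName_ratCode] at h
        exact hn ⟨q, h ▸ ht, rfl⟩
  · intro h
    refine ((h.comp hS hname).and hS (hS.decIn_primrec hvalid)).of_iff fun n => ?_
    rw [ratValid_iff]
    constructor
    · rintro ⟨q, hq, rfl⟩
      rw [ratVal_ratName_ratCode]
      exact ⟨hq, q, rfl⟩
    · rintro ⟨h, q, rfl⟩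
      rw [ratVal_ratName_ratCode] at h
      exact ⟨q, h, rfl⟩

theorem IsScottSet.rat_mem_realsOf (hS : IsScottSet S) (q : ℚ) : (q : ℝ) ∈ realsOf S := by
  rw [hS.mem_realsOf_iff]
  obtain ⟨t, rfl⟩ := ratVal_surjective q
  refine (hS.decIn_primrec (p := fun s => ratLT s t) (by fun_prop)).of_iff fun s => ?_
  rw [ratLT_iff, Rat.cast_lt]

/-- The two searches settle every rational other than `r`. If `r` is irrational there is no
exception; if it is rational, nothing needs to be searched. -/
theorem IsScottSet.mem_realsOf_of_search (hS : IsScottSet S) {β : Type} [Primcodable β] {r : ℝ}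
    {P Q : (ℕ × ℕ × ℕ) × β → Prop} (hP : DecIn S P) (hQ : DecIn S Q)
    (h : ∀ t, (ratVal t : ℝ) < r ↔ ∃ b, P (t, b)) (h' : ∀ t, r < ratVal t ↔ ∃ b, Q (t, b)) :
    r ∈ realsOf S := by
  by_cases hr : ∃ q : ℚ, (q : ℝ) = r
  · obtain ⟨q, rfl⟩ := hr
    exact hS.rat_mem_realsOf q
  · rw [hS.mem_realsOf_iff]
    refine DecIn.delta hS hP hQ h fun t => ?_
    rw [← h', not_lt]
    exact ⟨fun ht => lt_of_le_of_ne ht fun hc => hr ⟨_, hc.symm⟩, le_of_lt⟩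

/-- Names of rational boxes `[a, b] × [c, d]`. -/
abbrev RatBox : Type := ((ℕ × ℕ × ℕ) × (ℕ × ℕ × ℕ)) × ((ℕ × ℕ × ℕ) × (ℕ × ℕ × ℕ))

/-- A real number that can be approximated from below and above in terms of rational
approximations to two elements of `realsOf S` belongs to `realsOf S`. -/
theorem IsScottSet.mem_realsOf_of_boxes (hS : IsScottSet S) {r s u : ℝ} (hr : r ∈ realsOf S)
    (hs : s ∈ realsOf S)
    {p q : (ℕ × ℕ × ℕ) × RatBox → Bool}
    (hp : Primrec p) (hq : Primrec q) {P Q : ℚ → ℚ → ℚ → ℚ → ℚ → Prop}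
    (hpP : ∀ t a b c d, p (t, (a, b), (c, d)) = true ↔
      P (ratVal t) (ratVal a) (ratVal b) (ratVal c) (ratVal d))
    (hqQ : ∀ t a b c d, q (t, (a, b), (c, d)) = true ↔
      Q (ratVal t) (ratVal a) (ratVal b) (ratVal c) (ratVal d))
    (h : ∀ x : ℚ, (x : ℝ) < u ↔ ∃ a b c d : ℚ, (a < r ∧ r ≤ b ∧ c < s ∧ s ≤ d) ∧ P x a b c d)
    (h' : ∀ x : ℚ, u < (x : ℝ) ↔ ∃ a b c d : ℚ, (a < r ∧ r ≤ b ∧ c < s ∧ s ≤ d) ∧ Q x a b c d) :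
    u ∈ realsOf S := by
  rw [hS.mem_realsOf_iff] at hr hs
  have hbox : DecIn S fun z : (ℕ × ℕ × ℕ) × RatBox => (((ratVal z.2.1.1 : ℝ) < r ∧ ¬ (ratVal z.2.1.2 : ℝ) < r) ∧
        (ratVal z.2.2.1 : ℝ) < s ∧ ¬ (ratVal z.2.2.2 : ℝ) < s) :=
    ((hr.comp hS (f := fun z : (ℕ × ℕ × ℕ) × RatBox => z.2.1.1) (by fun_prop)).and hS
      ((hr.comp hS (f := fun z : (ℕ × ℕ × ℕ) × RatBox => z.2.1.2) (by fun_prop)).not hS)).and hS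
    ((hs.comp hS (f := fun z : (ℕ × ℕ × ℕ) × RatBox => z.2.2.1) (by fun_prop)).and hS
      ((hs.comp hS (f := fun z : (ℕ × ℕ × ℕ) × RatBox => z.2.2.2) (by fun_prop)).not hS))
  refine hS.mem_realsOf_of_search (hbox.and hS (hS.decIn_primrec hp))
    (hbox.and hS (hS.decIn_primrec hq)) (fun t => ?_) fun t => ?_
  · rw [h]
    constructor
    · rintro ⟨a, b, c, d, hb, hP⟩
      obtain ⟨a, rfl⟩ := ratVal_surjective a
      obtain ⟨b, rfl⟩ := ratVal_surjective b
      obtain ⟨c, rfl⟩ := ratVal_surjective c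
      obtain ⟨d, rfl⟩ := ratVal_surjective d
      exact ⟨((a, b), (c, d)), ⟨⟨hb.1, not_lt.2 hb.2.1⟩, hb.2.2.1, not_lt.2 hb.2.2.2⟩,
        (hpP _ _ _ _ _).2 hP⟩
    · rintro ⟨⟨⟨a, b⟩, ⟨c, d⟩⟩, ⟨⟨h1, h2⟩, h3, h4⟩, hP⟩
      exact ⟨_, _, _, _, ⟨h1, not_lt.1 h2, h3, not_lt.1 h4⟩, (hpP _ _ _ _ _).1 hP⟩
  · rw [h']
    constructor
    · rintro ⟨a, b, c, d, hb, hP⟩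
      obtain ⟨a, rfl⟩ := ratVal_surjective a
      obtain ⟨b, rfl⟩ := ratVal_surjective b
      obtain ⟨c, rfl⟩ := ratVal_surjective c
      obtain ⟨d, rfl⟩ := ratVal_surjective d
      exact ⟨((a, b), (c, d)), ⟨⟨hb.1, not_lt.2 hb.2.1⟩, hb.2.2.1, not_lt.2 hb.2.2.2⟩,
        (hqQ _ _ _ _ _).2 hP⟩
    · rintro ⟨⟨⟨a, b⟩, ⟨c, d⟩⟩, ⟨⟨h1, h2⟩, h3, h4⟩, hP⟩
      exact ⟨_, _, _, _, ⟨h1, not_lt.1 h2, h3, not_lt.1 h4⟩, (hqQ _ _ _ _ _).1 hP⟩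

/-- Small rational boxes around a point on whose vertices a given open condition holds. -/
theorem exists_rat_box {r s : ℝ} {U : ℝ → ℝ → Prop} (hU : IsOpen {p : ℝ × ℝ | U p.1 p.2})
    (h : U r s) : ∃ a b c d : ℚ, (a < r ∧ r ≤ b ∧ c < s ∧ s ≤ d) ∧
      U a c ∧ U a d ∧ U b c ∧ U b d := by
  obtain ⟨ε, hε, hball⟩ := Metric.isOpen_iff.1 hU (r, s) h
  obtain ⟨a, ha1, ha2⟩ := exists_rat_btwn (show r - ε < r by linarith)
  obtain ⟨b, hb1, hb2⟩ := exists_rat_btwn (show r < r + ε by linarith)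
  obtain ⟨c, hc1, hc2⟩ := exists_rat_btwn (show s - ε < s by linarith)
  obtain ⟨d, hd1, hd2⟩ := exists_rat_btwn (show s < s + ε by linarith)
  have key : ∀ x y : ℝ, |x - r| < ε → |y - s| < ε → U x y := by
    intro x y hx hy
    have : ((x, y) : ℝ × ℝ) ∈ Metric.ball (r, s) ε := by
      rw [Metric.mem_ball, Prod.dist_eq, max_lt_iff]
      exact ⟨hx, hy⟩
    exact hball this
  have ha : |(a : ℝ) - r| < ε := by rw [abs_lt]; constructor <;> linarith
  have hb : |(b : ℝ) - r| < ε := by rw [abs_lt]; constructor <;> linarith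
  have hc : |(c : ℝ) - s| < ε := by rw [abs_lt]; constructor <;> linarith
  have hd : |(d : ℝ) - s| < ε := by rw [abs_lt]; constructor <;> linarith
  exact ⟨a, b, c, d, ⟨ha2, hb1.le, hc2, hd1.le⟩, key _ _ ha hc, key _ _ ha hd, key _ _ hb hc,
    key _ _ hb hd⟩

theorem IsScottSet.add_mem_realsOf (hS : IsScottSet S) {r s : ℝ} (hr : r ∈ realsOf S)
    (hs : s ∈ realsOf S) : r + s ∈ realsOf S := by
  refine hS.mem_realsOf_of_boxes hr hs
    (p := fun z => ratLT z.1 (ratAdd z.2.1.1 z.2.2.1))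
    (q := fun z => ratLT (ratAdd z.2.1.2 z.2.2.2) z.1) (by fun_prop) (by fun_prop)
    (P := fun x a _ c _ => x < a + c) (Q := fun x _ b _ d => b + d < x)
    (fun _ _ _ _ _ => by rw [ratLT_iff, ratVal_add]) (fun _ _ _ _ _ => by rw [ratLT_iff, ratVal_add])
    (fun x => ⟨fun h => ?_, ?_⟩) (fun x => ⟨fun h => ?_, ?_⟩)
  · obtain ⟨a, b, c, d, h, h1, -⟩ := exists_rat_box (U := fun y z => (x : ℝ) < y + z)
      (isOpen_lt (by fun_prop) (by fun_prop)) h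
    exact ⟨a, b, c, d, h, by exact_mod_cast h1⟩
  · rintro ⟨a, b, c, d, h, h1⟩
    have : (x : ℝ) < a + c := by exact_mod_cast h1
    linarith
  · obtain ⟨a, b, c, d, h, -, -, -, h1⟩ := exists_rat_box (U := fun y z => y + z < (x : ℝ))
      (isOpen_lt (by fun_prop) (by fun_prop)) h
    exact ⟨a, b, c, d, h, by exact_mod_cast h1⟩
  · rintro ⟨a, b, c, d, h, h1⟩
    have : (b + d : ℝ) < x := by exact_mod_cast h1
    linarith

/-- The product is affine in each variable, so on a box it is bounded below by its least corner
value; the one-variable case is applied twice. -/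
theorem lt_mul_of_corners {x r s a b c d : ℝ} (hr : a ≤ r ∧ r ≤ b) (hs : c ≤ s ∧ s ≤ d)
    (h1 : x < a * c) (h2 : x < a * d) (h3 : x < b * c) (h4 : x < b * d) : x < r * s := by
  have key : ∀ y w a b : ℝ, a ≤ w ∧ w ≤ b → x < a * y → x < b * y → x < w * y := by
    rintro y w a b ⟨ha, hb⟩ h h'
    rcases le_total 0 y with hy | hy
    · exact h.trans_le (mul_le_mul_of_nonneg_right ha hy)
    · exact h'.trans_le (mul_le_mul_of_nonpos_right hb hy)
  have hc := key c r a b hr h1 h3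
  have hd := key d r a b hr h2 h4
  rw [mul_comm] at hc hd ⊢
  exact key r s c d hs hc hd

theorem IsScottSet.mul_mem_realsOf (hS : IsScottSet S) {r s : ℝ} (hr : r ∈ realsOf S)
    (hs : s ∈ realsOf S) : r * s ∈ realsOf S := by
  refine hS.mem_realsOf_of_boxes hr hs
    (p := fun z => (ratLT z.1 (ratMul z.2.1.1 z.2.2.1) && ratLT z.1 (ratMul z.2.1.1 z.2.2.2)) &&
      (ratLT z.1 (ratMul z.2.1.2 z.2.2.1) && ratLT z.1 (ratMul z.2.1.2 z.2.2.2)))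
    (q := fun z => (ratLT (ratMul z.2.1.1 z.2.2.1) z.1 && ratLT (ratMul z.2.1.1 z.2.2.2) z.1) &&
      (ratLT (ratMul z.2.1.2 z.2.2.1) z.1 && ratLT (ratMul z.2.1.2 z.2.2.2) z.1))
    (by fun_prop) (by fun_prop)
    (P := fun x a b c d => (x < a * c ∧ x < a * d) ∧ x < b * c ∧ x < b * d)
    (Q := fun x a b c d => (a * c < x ∧ a * d < x) ∧ b * c < x ∧ b * d < x)
    (fun _ _ _ _ _ => by simp only [Bool.and_eq_true, ratLT_iff, ratVal_mul])
    (fun _ _ _ _ _ => by simp only [Bool.and_eq_true, ratLT_iff, ratVal_mul])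
    (fun x => ⟨fun h => ?_, ?_⟩) (fun x => ⟨fun h => ?_, ?_⟩)
  · obtain ⟨a, b, c, d, h, h1, h2, h3, h4⟩ := exists_rat_box (U := fun y z => (x : ℝ) < y * z)
      (isOpen_lt (by fun_prop) (by fun_prop)) h
    exact ⟨a, b, c, d, h, ⟨by exact_mod_cast h1, by exact_mod_cast h2⟩, by exact_mod_cast h3,
      by exact_mod_cast h4⟩
  · rintro ⟨a, b, c, d, h, ⟨h1, h2⟩, h3, h4⟩
    exact lt_mul_of_corners ⟨h.1.le, h.2.1⟩ ⟨h.2.2.1.le, h.2.2.2⟩ (by exact_mod_cast h1)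
      (by exact_mod_cast h2) (by exact_mod_cast h3) (by exact_mod_cast h4)
  · obtain ⟨a, b, c, d, h, h1, h2, h3, h4⟩ := exists_rat_box (U := fun y z => y * z < (x : ℝ))
      (isOpen_lt (by fun_prop) (by fun_prop)) h
    exact ⟨a, b, c, d, h, ⟨by exact_mod_cast h1, by exact_mod_cast h2⟩, by exact_mod_cast h3,
      by exact_mod_cast h4⟩
  · rintro ⟨a, b, c, d, h, ⟨h1, h2⟩, h3, h4⟩
    have e1 : (a * c : ℝ) < x := by exact_mod_cast h1
    have e2 : (a * d : ℝ) < x := by exact_mod_cast h2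
    have e3 : (b * c : ℝ) < x := by exact_mod_cast h3
    have e4 : (b * d : ℝ) < x := by exact_mod_cast h4
    -- The upper bound follows from the lower one by reflecting the first factor.
    have := lt_mul_of_corners (x := -x) (r := -r) (s := s) (a := -b) (b := -a) (c := c) (d := d)
      ⟨by linarith [h.2.1], by linarith [h.1]⟩ ⟨h.2.2.1.le, h.2.2.2⟩ (by linarith) (by linarith)
      (by linarith) (by linarith)
    linarith

theorem IsScottSet.inv_mem_realsOf (hS : IsScottSet S) {r : ℝ} (hr : r ∈ realsOf S) :
    r⁻¹ ∈ realsOf S := by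
  rcases eq_or_ne r 0 with rfl | h0
  · simpa using hr
  have h0s : (0 : ℝ) ∈ realsOf S := by simpa using hS.rat_mem_realsOf 0
  have hlow : ∀ x : ℝ, x < r⁻¹ ↔ (0 < r ∧ x * r < 1) ∨ (r < 0 ∧ 1 < x * r) := by
    intro x
    rw [inv_eq_one_div]
    rcases lt_or_gt_of_ne h0 with hr0 | hr0
    · rw [lt_div_iff_of_neg hr0]
      simp [hr0, hr0.not_gt]
    · rw [lt_div_iff₀ hr0]
      simp [hr0, hr0.not_gt]
  have hupp : ∀ x : ℝ, r⁻¹ < x ↔ (0 < r ∧ 1 < x * r) ∨ (r < 0 ∧ x * r < 1) := by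
    intro x
    rw [inv_eq_one_div]
    rcases lt_or_gt_of_ne h0 with hr0 | hr0
    · rw [div_lt_iff_of_neg hr0]
      simp [hr0, hr0.not_gt]
    · rw [div_lt_iff₀ hr0]
      simp [hr0, hr0.not_gt]
  -- The second real is a dummy `0`. The box certifies the sign of `r`, and then `x * r` is compared
  -- with `1` at one of its endpoints.
  refine hS.mem_realsOf_of_boxes hr h0s
    (p := fun z => (ratLT (0, 0, 0) z.2.1.1 && ratLT (ratMul z.1 z.2.1.2) (1, 0, 0)) ||
      (ratLT z.2.1.2 (0, 0, 0) && ratLT (1, 0, 0) (ratMul z.1 z.2.1.2)))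
    (q := fun z => (ratLT (0, 0, 0) z.2.1.1 && ratLT (1, 0, 0) (ratMul z.1 z.2.1.1)) ||
      (ratLT z.2.1.2 (0, 0, 0) && ratLT (ratMul z.1 z.2.1.1) (1, 0, 0)))
    (by fun_prop) (by fun_prop)
    (P := fun x a b _ _ => (0 < a ∧ x * b < 1) ∨ (b < 0 ∧ 1 < x * b))
    (Q := fun x a b _ _ => (0 < a ∧ 1 < x * a) ∨ (b < 0 ∧ x * a < 1))
    (fun _ _ _ _ _ => by simp only [Bool.or_eq_true, Bool.and_eq_true, ratLT_iff, ratVal_mul,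
      ratVal_zero, ratVal_one])
    (fun _ _ _ _ _ => by simp only [Bool.or_eq_true, Bool.and_eq_true, ratLT_iff, ratVal_mul,
      ratVal_zero, ratVal_one])
    (fun x => ⟨fun h => ?_, ?_⟩) (fun x => ⟨fun h => ?_, ?_⟩)
  · rcases (hlow x).1 h with h | h
    · obtain ⟨a, b, c, d, hb, h1, -, h2, -⟩ := exists_rat_box
        (U := fun y _ => 0 < y ∧ (x : ℝ) * y < 1) ((isOpen_lt (by fun_prop) (by fun_prop)).and
          (isOpen_lt (by fun_prop) (by fun_prop))) (s := 0) h
      exact ⟨a, b, c, d, hb, .inl ⟨by exact_mod_cast h1.1, by exact_mod_cast h2.2⟩⟩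
    · obtain ⟨a, b, c, d, hb, -, -, h2, -⟩ := exists_rat_box
        (U := fun y _ => y < 0 ∧ 1 < (x : ℝ) * y) ((isOpen_lt (by fun_prop) (by fun_prop)).and
          (isOpen_lt (by fun_prop) (by fun_prop))) (s := 0) h
      exact ⟨a, b, c, d, hb, .inr ⟨by exact_mod_cast h2.1, by exact_mod_cast h2.2⟩⟩
  · rintro ⟨a, b, c, d, hb, ⟨h1, h2⟩ | ⟨h1, h2⟩⟩
    · have e1 : (0 : ℝ) < a := by exact_mod_cast h1
      have e2 : (x * b : ℝ) < 1 := by exact_mod_cast h2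
      refine (hlow x).2 (.inl ⟨e1.trans hb.1, ?_⟩)
      rcases le_total 0 (x : ℝ) with hx | hx
      · exact (mul_le_mul_of_nonneg_left hb.2.1 hx).trans_lt e2
      · exact (mul_nonpos_of_nonpos_of_nonneg hx (e1.trans hb.1).le).trans_lt one_pos
    · have e1 : (b : ℝ) < 0 := by exact_mod_cast h1
      have e2 : (1 : ℝ) < x * b := by exact_mod_cast h2
      refine (hlow x).2 (.inr ⟨hb.2.1.trans_lt e1, ?_⟩)
      rcases le_total 0 (x : ℝ) with hx | hx
      · linarith [mul_nonpos_of_nonneg_of_nonpos hx e1.le]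
      · exact e2.trans_le (mul_le_mul_of_nonpos_left hb.2.1 hx)
  · rcases (hupp x).1 h with h | h
    · obtain ⟨a, b, c, d, hb, h1, -⟩ := exists_rat_box
        (U := fun y _ => 0 < y ∧ 1 < (x : ℝ) * y) ((isOpen_lt (by fun_prop) (by fun_prop)).and
          (isOpen_lt (by fun_prop) (by fun_prop))) (s := 0) h
      exact ⟨a, b, c, d, hb, .inl ⟨by exact_mod_cast h1.1, by exact_mod_cast h1.2⟩⟩
    · obtain ⟨a, b, c, d, hb, h1, -, h2, -⟩ := exists_rat_box
        (U := fun y _ => y < 0 ∧ (x : ℝ) * y < 1) ((isOpen_lt (by fun_prop) (by fun_prop)).and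
          (isOpen_lt (by fun_prop) (by fun_prop))) (s := 0) h
      exact ⟨a, b, c, d, hb, .inr ⟨by exact_mod_cast h2.1, by exact_mod_cast h1.2⟩⟩
  · rintro ⟨a, b, c, d, hb, ⟨h1, h2⟩ | ⟨h1, h2⟩⟩
    · have e1 : (0 : ℝ) < a := by exact_mod_cast h1
      have e2 : (1 : ℝ) < x * a := by exact_mod_cast h2
      refine (hupp x).2 (.inl ⟨e1.trans hb.1, ?_⟩)
      rcases le_total 0 (x : ℝ) with hx | hx
      · exact e2.trans_le (mul_le_mul_of_nonneg_left hb.1.le hx)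
      · linarith [mul_nonpos_of_nonpos_of_nonneg hx e1.le]
    · have e1 : (b : ℝ) < 0 := by exact_mod_cast h1
      have e2 : (x * a : ℝ) < 1 := by exact_mod_cast h2
      refine (hupp x).2 (.inr ⟨hb.2.1.trans_lt e1, ?_⟩)
      rcases le_total 0 (x : ℝ) with hx | hx
      · exact (mul_nonpos_of_nonneg_of_nonpos hx (hb.2.1.trans_lt e1).le).trans_lt one_pos
      · exact (mul_le_mul_of_nonpos_left hb.1.le hx).trans_lt e2

/-- The subfield of `ℝ` consisting of the reals computable in some element of a Scott set. -/
def IsScottSet.field (hS : IsScottSet S) : Subfield ℝ where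
  carrier := realsOf S
  mul_mem' := hS.mul_mem_realsOf
  one_mem' := by simpa using hS.rat_mem_realsOf 1
  add_mem' := hS.add_mem_realsOf
  zero_mem' := by simpa using hS.rat_mem_realsOf 0
  neg_mem' := fun {r} hr => by
    have := hS.mul_mem_realsOf (hS.rat_mem_realsOf (-1)) hr
    simpa using this
  inv_mem' := fun _ hr => hS.inv_mem_realsOf hr

end

noncomputable section

/-! ### Signs of linear forms in finitely many elements -/

variable {S : Set (ℕ → Bool)}

theorem DecIn.exists_finset (hS : IsScottSet S) {α ι : Type} [Primcodable α] (Q : Finset ι)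
    {P : ι → α → Prop} (hP : ∀ i ∈ Q, DecIn S (P i)) : DecIn S fun a => ∃ i ∈ Q, P i a := by
  classical
  induction Q using Finset.induction_on with
  | empty => exact (hS.decIn_primrec (p := fun _ : α => false) (by fun_prop)).of_iff (by simp)
  | insert i Q _ ih =>
    exact ((hP i (by simp)).or hS (ih fun j hj => hP j (by simp [hj]))).of_iff (by simp)

theorem DecIn.forall_finset (hS : IsScottSet S) {α ι : Type} [Primcodable α] (Q : Finset ι)
    {P : ι → α → Prop} (hP : ∀ i ∈ Q, DecIn S (P i)) : DecIn S fun a => ∀ i ∈ Q, P i a :=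
  ((exists_finset hS Q fun i hi => (hP i hi).not hS).not hS).of_iff fun a => by push Not; rfl

/-- Only finitely many indices matter, so a decision procedure uniform in the index is assembled
from the separate cuts by a finite case distinction. -/
theorem IsScottSet.decIn_cuts (hS : IsScottSet S) {r : ℕ → ℝ} (hr : ∀ i, r i ∈ realsOf S)
    {n : ℕ} (hn : ∀ i, n ≤ i → r i = 0) :
    DecIn S fun p : ℕ × ℕ × ℕ × ℕ => (ratVal p.2 : ℝ) < r p.1 := by
  have h1 : DecIn S fun p : ℕ × ℕ × ℕ × ℕ => ∃ i ∈ Finset.range n,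
      decide (p.1 = i) = true ∧ (ratVal p.2 : ℝ) < r i :=
    DecIn.exists_finset hS _ fun i _ => (hS.decIn_primrec (by fun_prop)).and hS
      ((hS.mem_realsOf_iff.1 (hr i)).comp hS Primrec.snd)
  have h2 : DecIn S fun p : ℕ × ℕ × ℕ × ℕ =>
      (decide (n ≤ p.1) && ratLT p.2 (0, 0, 0)) = true := hS.decIn_primrec (by fun_prop)
  refine (h1.or hS h2).of_iff fun p => ?_
  simp only [Finset.mem_range, decide_eq_true_eq, Bool.and_eq_true, ratLT_iff, ratVal_zero]
  rcases lt_or_ge p.1 n with h | h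
  · exact ⟨fun h' => .inl ⟨_, h, rfl, h'⟩, by
      rintro (⟨i, -, rfl, h'⟩ | ⟨h', -⟩)
      · exact h'
      · omega⟩
  · rw [hn _ h]
    constructor
    · exact fun h' => .inr ⟨h, by exact_mod_cast h'⟩
    · rintro (⟨i, h', rfl, -⟩ | ⟨-, h'⟩)
      · omega
      · exact_mod_cast h'

/-- The name of the sum of a list of named rational numbers. -/
def ratSum (l : List (ℕ × ℕ × ℕ)) : ℕ × ℕ × ℕ := l.foldr (fun s t => ratAdd s t) (0, 0, 0)

theorem ratVal_ratSum (l : List (ℕ × ℕ × ℕ)) : ratVal (ratSum l) = (l.map ratVal).sum := by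
  induction l with
  | nil => simp [ratSum, ratVal_zero]
  | cons s l ih => rw [ratSum, List.foldr_cons, ← ratSum, ratVal_add, ih, List.map_cons,
      List.sum_cons]

@[fun_prop]
theorem primrec_ratSum {α : Type} [Primcodable α] {f : α → List (ℕ × ℕ × ℕ)} (hf : Primrec f) :
    Primrec fun a => ratSum (f a) := by
  unfold ratSum; fun_prop

theorem lsum_linearMap {M : Type} [AddCommGroup M] [Module ℚ M] (f : M →ₗ[ℚ] ℚ) (ρ : ℕ → M)
    (l : List ℕ) : lsum (fun i => f (ρ i)) l = f (lsum ρ l) := by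
  simp [lsum, map_list_sum, Function.comp_def]

/-- The linear relations between finitely many reals are decidable. -/
theorem IsScottSet.decIn_lsum_eq (hS : IsScottSet S) {r : ℕ → ℝ} {n : ℕ}
    (hn : ∀ i, n ≤ i → r i = 0) :
    DecIn S fun e : List ℕ × List ℕ => lsum r e.1 = lsum r e.2 := by
  have hfin : (Set.range r).Finite := by
    refine ((Finset.image r (Finset.range (n + 1))).finite_toSet).subset ?_
    rintro _ ⟨i, rfl⟩
    rcases lt_or_ge i n with h | h
    · exact Finset.mem_coe.2 (Finset.mem_image.2 ⟨i, by simp; omega, rfl⟩)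
    · exact Finset.mem_coe.2 (Finset.mem_image.2 ⟨n, by simp, by rw [hn _ h, hn _ le_rfl]⟩)
  have : FiniteDimensional ℚ (Submodule.span ℚ (Set.range r)) :=
    FiniteDimensional.span_of_finite ℚ hfin
  obtain ⟨d, hd⟩ : ∃ d, Module.finrank ℚ (Submodule.span ℚ (Set.range r)) = d := ⟨_, rfl⟩
  -- Equality of reals cannot be tested by approximation. In a rational basis of the span it becomes
  -- equality of finitely many rational coordinates.
  let B := Module.finBasisOfFinrankEq ℚ (Submodule.span ℚ (Set.range r)) hd
  let ρ : ℕ → Submodule.span ℚ (Set.range r) := fun i => ⟨r i, Submodule.subset_span ⟨i, rfl⟩⟩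
  have hρ : ∀ l, ((lsum ρ l : Submodule.span ℚ (Set.range r)) : ℝ) = lsum r l := by
    intro l
    induction l with
    | nil => rfl
    | cons x l ih => rw [lsum_cons, lsum_cons, Submodule.coe_add, ih]
  choose T hT using fun j i => ratVal_surjective (B.coord j (ρ i))
  have hcoord : ∀ j, DecIn S fun e : List ℕ × List ℕ =>
      B.coord j (lsum ρ e.1) = B.coord j (lsum ρ e.2) := by
    intro j
    -- A finite table of coordinate names suffices: `r i` vanishes for `i ≥ n`, matching the default
    -- name `(0, 0, 0)` of zero.
    have key : ∀ l, ratVal (ratSum (l.map fun i =>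
        ((List.range n).map (T j)).getD i (0, 0, 0))) = B.coord j (lsum ρ l) := by
      intro l
      rw [ratVal_ratSum, ← lsum_linearMap, lsum, List.map_map]
      congr 2
      funext i
      simp only [Function.comp_apply]
      rcases lt_or_ge i n with h | h
      · rw [List.getD_eq_getElem _ _ (by simpa using h)]
        simp [hT]
      · rw [List.getD_eq_default _ _ (by simpa using h), ratVal_zero]
        have : ρ i = 0 := Subtype.ext (hn i h)
        rw [this, map_zero]
    refine (hS.decIn_primrec (p := fun e : List ℕ × List ℕ =>
      !ratLT (ratSum (e.1.map fun i => ((List.range n).map (T j)).getD i (0, 0, 0)))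
          (ratSum (e.2.map fun i => ((List.range n).map (T j)).getD i (0, 0, 0))) &&
        !ratLT (ratSum (e.2.map fun i => ((List.range n).map (T j)).getD i (0, 0, 0)))
          (ratSum (e.1.map fun i => ((List.range n).map (T j)).getD i (0, 0, 0)))) ?_).of_iff
        fun e => ?_
    · generalize (List.range n).map (T j) = L
      fun_prop
    · rw [Bool.and_eq_true, Bool.not_eq_true', Bool.not_eq_true', ← Bool.not_eq_true,
        ← Bool.not_eq_true, ratLT_iff, ratLT_iff, key, key, not_lt, not_lt, and_comm,
        le_antisymm_iff]
  refine (DecIn.forall_finset hS Finset.univ fun j _ => hcoord j).of_iff fun e => ?_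
  rw [← hρ, ← hρ, Subtype.coe_inj, B.ext_elem_iff]
  simp

/-- Each entry pairs an occurrence of a variable with a rational below its value; half of the error
is spent on the head and half on the tail. -/
theorem exists_lower_approx {r : ℕ → ℝ} (l : List ℕ) {δ : ℝ} (hδ : 0 < δ) :
    ∃ L : List (ℕ × ℕ × ℕ × ℕ), L.map (fun p => p.1) = l ∧
      (∀ p ∈ L, (ratVal p.2 : ℝ) < r p.1) ∧
      lsum r l - δ < (ratVal (ratSum (L.map fun p => p.2)) : ℝ) := by
  induction l generalizing δ with
  | nil => exact ⟨[], rfl, by simp, by simpa [lsum, ratSum, ratVal_zero] using hδ⟩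
  | cons i l ih =>
    obtain ⟨L, h1, h2, h3⟩ := ih (half_pos hδ)
    obtain ⟨q, hq1, hq2⟩ := exists_rat_btwn (sub_lt_self (r i) (half_pos hδ))
    obtain ⟨t, rfl⟩ := ratVal_surjective q
    refine ⟨(i, t) :: L, by simp [h1], by simpa using ⟨hq2, by simpa using h2⟩, ?_⟩
    rw [List.map_cons, ratSum, List.foldr_cons, ← ratSum, ratVal_add, lsum_cons]
    push_cast
    linarith

theorem exists_upper_approx {r : ℕ → ℝ} (l : List ℕ) {δ : ℝ} (hδ : 0 < δ) :
    ∃ L : List (ℕ × ℕ × ℕ × ℕ), L.map (fun p => p.1) = l ∧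
      (∀ p ∈ L, ¬ (ratVal p.2 : ℝ) < r p.1) ∧
      (ratVal (ratSum (L.map fun p => p.2)) : ℝ) < lsum r l + δ := by
  induction l generalizing δ with
  | nil => exact ⟨[], rfl, by simp, by simpa [lsum, ratSum, ratVal_zero] using hδ⟩
  | cons i l ih =>
    obtain ⟨L, h1, h2, h3⟩ := ih (half_pos hδ)
    obtain ⟨q, hq1, hq2⟩ := exists_rat_btwn (lt_add_of_pos_right (r i) (half_pos hδ))
    obtain ⟨t, rfl⟩ := ratVal_surjective q
    refine ⟨(i, t) :: L, by simp [h1], by simpa using ⟨hq1.le, by simpa using h2⟩, ?_⟩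
    rw [List.map_cons, ratSum, List.foldr_cons, ← ratSum, ratVal_add, lsum_cons]
    push_cast
    linarith

theorem ratSum_le_lsum {r : ℕ → ℝ} (L : List (ℕ × ℕ × ℕ × ℕ))
    (h : ∀ p ∈ L, (ratVal p.2 : ℝ) < r p.1) :
    (ratVal (ratSum (L.map fun p => p.2)) : ℝ) ≤ lsum r (L.map fun p => p.1) := by
  induction L with
  | nil => simp [lsum, ratSum, ratVal_zero]
  | cons p L ih =>
    rw [List.map_cons, ratSum, List.foldr_cons, ← ratSum, ratVal_add, List.map_cons, lsum_cons]
    push_cast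
    exact add_le_add (h p (by simp)).le (ih fun q hq => h q (by simp [hq]))

theorem lsum_le_ratSum {r : ℕ → ℝ} (L : List (ℕ × ℕ × ℕ × ℕ))
    (h : ∀ p ∈ L, ¬ (ratVal p.2 : ℝ) < r p.1) :
    lsum r (L.map fun p => p.1) ≤ (ratVal (ratSum (L.map fun p => p.2)) : ℝ) := by
  induction L with
  | nil => simp [lsum, ratSum, ratVal_zero]
  | cons p L ih =>
    rw [List.map_cons, List.map_cons, ratSum, List.foldr_cons, ← ratSum, ratVal_add, lsum_cons]
    push_cast
    exact add_le_add (not_lt.1 (h p (by simp))) (ih fun q hq => h q (by simp [hq]))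

/-- The signs of linear forms in finitely many elements of `realsOf S` are decidable. -/
theorem IsScottSet.decIn_lsum_lt_real (hS : IsScottSet S) {r : ℕ → ℝ}
    (hr : ∀ i, r i ∈ realsOf S) {n : ℕ} (hn : ∀ i, n ≤ i → r i = 0) :
    DecIn S fun e : List ℕ × List ℕ => lsum r e.1 < lsum r e.2 := by
  have hcut := hS.decIn_cuts hr hn
  have hlist : DecIn S fun L : List (ℕ × ℕ × ℕ × ℕ) => ∀ p ∈ L, (ratVal p.2 : ℝ) < r p.1 :=
    (hcut.comp hS (f := fun z : List (ℕ × ℕ × ℕ × ℕ) × (ℕ × ℕ × ℕ × ℕ) => z.2)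
      (by fun_prop)).forall_mem hS Primrec.id
  have hlist' : DecIn S fun L : List (ℕ × ℕ × ℕ × ℕ) => ∀ p ∈ L, ¬ (ratVal p.2 : ℝ) < r p.1 :=
    ((hcut.not hS).comp hS (f := fun z : List (ℕ × ℕ × ℕ × ℕ) × (ℕ × ℕ × ℕ × ℕ) => z.2)
      (by fun_prop)).forall_mem hS Primrec.id
  have hP : DecIn S fun z : (List ℕ × List ℕ) × (List (ℕ × ℕ × ℕ × ℕ) × List (ℕ × ℕ × ℕ × ℕ)) =>
      ((decide (z.2.1.map (fun p => p.1) = z.1.1) && decide (z.2.2.map (fun p => p.1) = z.1.2)) &&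
        ratLT (ratSum (z.2.1.map fun p => p.2)) (ratSum (z.2.2.map fun p => p.2))) = true ∧
      (∀ p ∈ z.2.1, ¬ (ratVal p.2 : ℝ) < r p.1) ∧ ∀ p ∈ z.2.2, (ratVal p.2 : ℝ) < r p.1 :=
    (hS.decIn_primrec (by fun_prop)).and hS ((hlist'.comp hS (by fun_prop)).and hS
      (hlist.comp hS (by fun_prop)))
  -- A strict inequality is witnessed by rational upper bounds on the left and lower bounds on the
  -- right whose sums are already ordered; each side may use up half of the gap.
  have hspec : ∀ e : List ℕ × List ℕ, lsum r e.1 < lsum r e.2 ↔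
      ∃ b : List (ℕ × ℕ × ℕ × ℕ) × List (ℕ × ℕ × ℕ × ℕ),
      ((decide (b.1.map (fun p => p.1) = e.1) && decide (b.2.map (fun p => p.1) = e.2)) &&
        ratLT (ratSum (b.1.map fun p => p.2)) (ratSum (b.2.map fun p => p.2))) = true ∧
      (∀ p ∈ b.1, ¬ (ratVal p.2 : ℝ) < r p.1) ∧ ∀ p ∈ b.2, (ratVal p.2 : ℝ) < r p.1 := by
    intro e
    simp only [Bool.and_eq_true, decide_eq_true_eq, ratLT_iff]
    constructor
    · intro h
      have hδ : 0 < (lsum r e.2 - lsum r e.1) / 2 := by linarith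
      obtain ⟨U, hU1, hU2, hU3⟩ := exists_upper_approx (r := r) e.1 hδ
      obtain ⟨L, hL1, hL2, hL3⟩ := exists_lower_approx (r := r) e.2 hδ
      refine ⟨(U, L), ⟨⟨hU1, hL1⟩, ?_⟩, hU2, hL2⟩
      rw [← Rat.cast_lt (K := ℝ)]
      linarith
    · rintro ⟨⟨U, L⟩, ⟨⟨hU1, hL1⟩, h⟩, hU, hL⟩
      have h1 := lsum_le_ratSum U hU
      have h2 := ratSum_le_lsum L hL
      rw [hU1] at h1
      rw [hL1] at h2
      have h3 : (ratVal (ratSum (U.map fun p => p.2)) : ℝ) <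
        ratVal (ratSum (L.map fun p => p.2)) := by exact_mod_cast h
      linarith
  -- Failure means equality, which is decidable, or the reversed strict inequality, which has a
  -- witness of the same kind.
  have hQ := (((hS.decIn_lsum_eq hn).comp hS (f := fun z : (List ℕ × List ℕ) ×
      (List (ℕ × ℕ × ℕ × ℕ) × List (ℕ × ℕ × ℕ × ℕ)) => z.1) (by fun_prop)).or hS
    (hP.comp hS (f := fun z => ((z.1.2, z.1.1), z.2)) (by fun_prop)))
  refine DecIn.delta hS hP hQ hspec fun e => ?_
  rw [not_lt, le_iff_lt_or_eq, exists_or, ← hspec (e.2, e.1)]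
  simp only [exists_const]
  rw [or_comm, eq_comm]

/-- The group of finitely supported functions from `ℚ` to `k`, ordered lexicographically. -/
theorem lex_isDivisible (k : Subfield ℝ) : IsDivisibleOrderedAbelianGroup (Lex (ℚ →₀ k)) where
  isOrdered := inferInstance
  nontrivial := inferInstanceAs (Nontrivial (ℚ →₀ k))
  divisible n hn g := by
    refine ⟨toLex (((n : k)⁻¹) • ofLex g), ?_⟩
    have hn' : (n : k) ≠ 0 := by exact_mod_cast hn
    apply ofLex.injective
    change n • ((n : k)⁻¹ • ofLex g) = ofLex g
    rw [← Nat.cast_smul_eq_nsmul k, smul_inv_smul₀ hn']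

theorem lsum_lex_apply {k : Subfield ℝ} (ρ : ℕ → Lex (ℚ →₀ k)) (l : List ℕ) (q : ℚ) :
    ((ofLex (lsum ρ l) q : k) : ℝ) = lsum (fun i => ((ofLex (ρ i) q : k) : ℝ)) l := by
  induction l with
  | nil => simp [lsum]
  | cons x l ih => simp [lsum_cons, ih]

theorem lex_lt_iff {k : Subfield ℝ} {f g : Lex (ℚ →₀ k)} :
    f < g ↔ ∃ q, (∀ q' < q, ofLex f q' = ofLex g q') ∧ ofLex f q < ofLex g q :=
  Iff.rfl

/-- The signs of linear forms in finitely many elements of the lexicographically ordered group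
of finitely supported functions are decidable. -/
theorem IsScottSet.decIn_lsum_lt (hS : IsScottSet S) {k : Subfield ℝ}
    (hk : (k : Set ℝ) = realsOf S) {ρ : ℕ → Lex (ℚ →₀ k)} {n : ℕ} (hn : ∀ i, n ≤ i → ρ i = 0) :
    DecIn S fun e : List ℕ × List ℕ => lsum ρ e.1 < lsum ρ e.2 := by
  classical
  have hlt : ∀ q, DecIn S fun e : List ℕ × List ℕ =>
      ofLex (lsum ρ e.1) q < ofLex (lsum ρ e.2) q := by
    intro q
    have := hS.decIn_lsum_lt_real (r := fun i => ((ofLex (ρ i) q : k) : ℝ)) (n := n)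
      (fun i => hk ▸ (ofLex (ρ i) q).2) (fun i hi => by simp [hn i hi])
    refine this.of_iff fun e => ?_
    rw [← Subtype.coe_lt_coe, lsum_lex_apply, lsum_lex_apply]
  have heq : ∀ q, DecIn S fun e : List ℕ × List ℕ =>
      ofLex (lsum ρ e.1) q = ofLex (lsum ρ e.2) q := by
    intro q
    refine (((hlt q).not hS).and hS (((hlt q).comp hS (f := fun e => (e.2, e.1))
      (by fun_prop)).not hS)).of_iff fun e => ?_
    rw [not_lt, not_lt, and_comm, le_antisymm_iff]
  -- All sums vanish outside `Q`, so the first coordinate of difference lies in `Q`, and the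
  -- quantifiers over `ℚ` in the lexicographic order become finite.
  let Q : Finset ℚ := (Finset.range n).biUnion fun i => (ofLex (ρ i)).support
  have hQ : ∀ q ∉ Q, ∀ l, ofLex (lsum ρ l) q = 0 := by
    intro q hq l
    have h0 : ∀ i, ofLex (ρ i) q = 0 := by
      intro i
      rcases lt_or_ge i n with h | h
      · by_contra hc
        exact hq (Finset.mem_biUnion.2 ⟨i, Finset.mem_range.2 h, Finsupp.mem_support_iff.2 hc⟩)
      · rw [hn i h]; rfl
    induction l with
    | nil => rfl
    | cons x l ih => rw [lsum_cons, ofLex_add, Finsupp.add_apply, h0, ih, zero_add]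
  refine (DecIn.exists_finset hS Q fun q _ => (DecIn.forall_finset hS (Q.filter (· < q))
    fun q' _ => heq q').and hS (hlt q)).of_iff fun e => ?_
  rw [lex_lt_iff]
  constructor
  · rintro ⟨q, h, h'⟩
    refine ⟨q, ?_, fun q' hq' => h q' (Finset.mem_filter.1 hq').2, h'⟩
    by_contra hq
    rw [hQ q hq, hQ q hq] at h'
    exact lt_irrefl _ h'
  · rintro ⟨q, hq, h, h'⟩
    refine ⟨q, fun q' hq' => ?_, h'⟩
    by_cases hmem : q' ∈ Q
    · exact h q' (Finset.mem_filter.2 ⟨hmem, hq'⟩)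
    · rw [hQ q' hmem, hQ q' hmem]

/-- The valuation of the codes of variables determined by the values of the free variables. -/
def codeVal {G : Type} [Zero G] {m : ℕ} (v : Fin m → G) (c : ℕ) : G :=
  if h : c / 2 < m ∧ c % 2 = 0 then v ⟨c / 2, h.1⟩ else 0

theorem codeVal_inl {G : Type} [Zero G] {m : ℕ} (v : Fin m → G) (i : Fin m) :
    codeVal v (2 * i) = v i := by
  simp [codeVal]

theorem IsDivisibleOrderedAbelianGroup.realize_formula_iff {G : Type} [AddCommGroup G]
    [LinearOrder G] (hG : IsDivisibleOrderedAbelianGroup G) {m : ℕ} (φ : og.Formula (Fin m))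
    (v : Fin m → G) : φ.Realize v ↔ dnfHolds (codeVal v) (formDNF φ) := by
  refine hG.realize_iff φ fun a => ?_
  rcases a with i | j
  · exact codeVal_inl v i
  · exact j.elim0

/-- The set of formulas satisfied by a tuple is decidable. -/
theorem IsScottSet.computableInSome_realized (hS : IsScottSet S) {k : Subfield ℝ}
    (hk : (k : Set ℝ) = realsOf S) {m : ℕ} (v : Fin m → Lex (ℚ →₀ k)) :
    ComputableInSome S formulaCode {φ : og.Formula (Fin m) | φ.Realize v} := by
  have hlt : DecIn S fun e : List ℕ × List ℕ => lsum (codeVal v) e.1 < lsum (codeVal v) e.2 :=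
    hS.decIn_lsum_lt hk (n := 2 * m) fun i hi => by
      rw [codeVal, dif_neg (by omega)]
  have hholds : DecIn S fun e : Ineq => e.Holds (codeVal v) := by
    refine (((hS.decIn_primrec (p := fun e : Ineq => e.1) (by fun_prop)).and hS
      (hlt.comp hS (f := fun e : Ineq => e.2) (by fun_prop))).or hS
      ((hS.decIn_primrec (p := fun e : Ineq => !e.1) (by fun_prop)).and hS
      ((hlt.comp hS (f := fun e : Ineq => (e.2.2, e.2.1)) (by fun_prop)).not hS))).of_iff
        fun e => ?_
    rcases e with ⟨_ | _, l, r⟩ <;> simp [Ineq.Holds]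
  have hclause : DecIn S fun C : List Ineq => ∀ e ∈ C, e.Holds (codeVal v) :=
    (hholds.comp hS (f := fun z : List Ineq × Ineq => z.2) (by fun_prop)).forall_mem hS Primrec.id
  have hdec : Primrec fun c => formDecode m 0 c :=
    primrec_formDecode.comp (f := fun b : ℕ × ℕ × ℕ => formDecode b.1 b.2.1 b.2.2)
      (g := fun c => (m, 0, c)) (by fun_prop)
  -- A number that codes no formula decodes to the empty disjunction, which is false, so it is
  -- rejected.
  have := (hclause.comp hS (f := fun z : ℕ × List Ineq => z.2) (by fun_prop)).exists_mem hS
    (f := fun c => (formDecode m 0 c).elim [] id) (by fun_prop)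
  rw [hS.computableInSome_iff]
  refine this.of_iff fun c => ?_
  constructor
  · rintro ⟨φ, hφ, rfl⟩
    rw [formDecode_formulaCode]
    exact ((lex_isDivisible k).realize_formula_iff φ v).1 hφ
  · rcases hc : formDecode m 0 c with _ | D
    · simp
    · intro h
      obtain ⟨φ, rfl⟩ := exists_formula_of_formDecode (by rw [hc]; rfl)
      rw [formDecode_formulaCode, Option.some.injEq] at hc
      subst hc
      exact ⟨φ, ((lex_isDivisible k).realize_formula_iff φ v).2 h, rfl⟩

end

noncomputable section

/-! ### Realizing cuts in the lexicographically ordered group -/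

section Cuts

variable {k : Subfield ℝ}

theorem lex_lt_of {f g : Lex (ℚ →₀ k)} {q : ℚ} (h : ∀ q' < q, ofLex f q' = ofLex g q')
    (h' : ofLex f q < ofLex g q) : f < g := ⟨q, h, h'⟩

theorem ofLex_rat_smul (t : ℚ) (f : Lex (ℚ →₀ k)) (q : ℚ) :
    ((ofLex (t • f) q : k) : ℝ) = t * (ofLex f q : k) := by
  change (((t • (ofLex f q : k) : k)) : ℝ) = _
  rw [Rat.smul_def]
  push_cast
  rfl

/-- A cut above or below a whole subspace is realized. -/
theorem exists_realize_extreme_cut (Q : Finset ℚ) (W : Set (Lex (ℚ →₀ k)))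
    {D : Set (Lex (ℚ →₀ k))} {q₀ : ℚ} (hq₀ : ∀ q ∈ Q, q₀ < q)
    (hsupp : ∀ w ∈ W, (ofLex w).support ⊆ Q) (h : (∀ v ∈ W, v ∈ D) ∨ ∀ v ∈ W, v ∉ D) :
    ∃ b : Lex (ℚ →₀ k), (∀ q ≤ q₀, ofLex b q = 0) ∧
      ∀ v ∈ W, (v ∈ D → v < b) ∧ (v ∉ D → b < v) := by
  -- All of `W` vanishes at `q₁` and before it, so the value `1` or `-1` at `q₁` outweighs every
  -- element of `W`.
  obtain ⟨q₁, h1, h2⟩ := Order.exists_between_finsets (lo := {q₀}) (hi := Q) (by simpa using hq₀)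
  have hw : ∀ w ∈ W, ∀ q ≤ q₁, ofLex w q = 0 := fun w hw q hq => by
    by_contra hc
    exact (h2 q (hsupp w hw (Finsupp.mem_support_iff.2 hc))).not_ge hq
  have hsingle : ∀ (c : k) (q : ℚ), q < q₁ → ofLex (toLex (Finsupp.single q₁ c)) q = 0 :=
    fun c q hq => Finsupp.single_eq_of_ne hq.ne
  have hself : ∀ c : k, ofLex (toLex (Finsupp.single q₁ c)) q₁ = c :=
    fun c => Finsupp.single_eq_same
  have h10 : q₀ < q₁ := h1 _ (by simp)
  rcases h with h | h
  · refine ⟨toLex (Finsupp.single q₁ 1), fun q hq => hsingle _ q (hq.trans_lt h10),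
      fun v hv => ⟨fun _ => lex_lt_of (q := q₁) (fun q hq => ?_) ?_, fun hD => absurd (h v hv) hD⟩⟩
    · rw [hsingle _ q hq, hw v hv q hq.le]
    · rw [hself, hw v hv _ le_rfl]
      exact one_pos
  · refine ⟨toLex (Finsupp.single q₁ (-1)), fun q hq => hsingle _ q (hq.trans_lt h10),
      fun v hv => ⟨fun hD => absurd hD (h v hv), fun _ => lex_lt_of (q := q₁) (fun q hq => ?_) ?_⟩⟩
    · rw [hsingle _ q hq, hw v hv q hq.le]
    · rw [hself, hw v hv _ le_rfl]
      exact neg_one_lt_zero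

/-- A cut of a finite-dimensional rational subspace is realized if all real numbers that it
defines along lines belong to `k`. -/
theorem exists_realize_cut (Q : Finset ℚ) : ∀ (W : Submodule ℚ (Lex (ℚ →₀ k)))
    (D : Set (Lex (ℚ →₀ k))) (q₀ : ℚ), (∀ q ∈ Q, q₀ < q) →
    (∀ w ∈ W, (ofLex w).support ⊆ Q) →
    (∀ v ∈ W, ∀ v' ∈ W, v ≤ v' → v' ∈ D → v ∈ D) →
    (∀ u ∈ W, ∀ w ∈ W, ∀ r : ℝ, (∀ t : ℚ, (t : ℝ) < r → u + t • w ∈ D) →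
      (∀ t : ℚ, r < t → u + t • w ∉ D) → r ∈ k) →
    ∃ b : Lex (ℚ →₀ k), (∀ q ≤ q₀, ofLex b q = 0) ∧
      ∀ v ∈ W, (v ∈ D → v < b) ∧ (v ∉ D → b < v) := by
  induction Q using Finset.induction_on_min with
  | empty =>
    intro W D q₀ hq₀ hsupp hD _
    refine exists_realize_extreme_cut ∅ (W : Set (Lex (ℚ →₀ k))) hq₀ hsupp ?_
    have h0 : ∀ w ∈ W, w = 0 := fun w hw => by
      have := Finset.subset_empty.1 (hsupp w hw)
      exact ofLex.injective (Finsupp.support_eq_empty.1 this)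
    by_cases h : (0 : Lex (ℚ →₀ k)) ∈ D
    · exact .inl fun w hw => h0 w hw ▸ h
    · exact .inr fun w hw => h0 w hw ▸ h
  | insert q₁ Q hmin ih =>
    intro W D q₀ hq₀ hsupp hD hk
    by_cases hext : (∀ v ∈ (W : Set (Lex (ℚ →₀ k))), v ∈ D) ∨
        ∀ v ∈ (W : Set (Lex (ℚ →₀ k))), v ∉ D
    · exact exists_realize_extreme_cut _ _ hq₀ hsupp hext
    push Not at hext
    obtain ⟨⟨v₂, hv₂W, hv₂⟩, v₁, hv₁W, hv₁⟩ := hext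
    have hq₁ : q₀ < q₁ := hq₀ _ (by simp)
    have hz : ∀ w ∈ W, ∀ q < q₁, ofLex w q = 0 := fun w hw q hq => by
      by_contra hc
      have := hsupp w hw (Finsupp.mem_support_iff.2 hc)
      rcases Finset.mem_insert.1 this with rfl | h
      · exact lt_irrefl _ hq
      · exact (hmin q h).not_gt hq
    have hlt : ∀ v ∈ W, ∀ w ∈ W, ofLex v q₁ < ofLex w q₁ → v < w := fun v hv w hw h =>
      lex_lt_of (q := q₁) (fun q hq => by rw [hz v hv q hq, hz w hw q hq]) h
    have hsupp' : ∀ w ∈ W, ofLex w q₁ = 0 → (ofLex w).support ⊆ Q := fun w hw h0 q hq => by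
      rcases Finset.mem_insert.1 (hsupp w hw hq) with rfl | h
      · exact absurd h0 (Finsupp.mem_support_iff.1 hq)
      · exact h
    -- If `W` vanishes at the dominant coordinate, that coordinate can be dropped.
    by_cases hc : ∀ w ∈ W, ofLex w q₁ = 0
    · obtain ⟨b, hb, hb'⟩ := ih W D q₁ hmin (fun w hw => hsupp' w hw (hc w hw)) hD hk
      exact ⟨b, fun q hq => hb q (hq.trans hq₁.le), hb'⟩
    push Not at hc
    obtain ⟨w₀, hw₀, hc₀⟩ : ∃ w ∈ W, 0 < ofLex w q₁ := by
      obtain ⟨w, hw, h⟩ := hc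
      rcases lt_or_gt_of_ne h with h | h
      · exact ⟨-w, W.neg_mem hw, by simpa using h⟩
      · exact ⟨w, hw, h⟩
    have hc₀' : (0 : ℝ) < (ofLex w₀ q₁ : k) := hc₀
    have hline : ∀ t : ℚ, t • w₀ ∈ W := fun t => W.smul_mem t hw₀
    let T : Set ℝ := {x | ∃ t : ℚ, (t : ℝ) = x ∧ t • w₀ ∈ D}
    -- Multiples of `w₀` below `v₁ ∈ D` and above `v₂ ∉ D`: the cut along the line of `w₀` is
    -- nonempty and bounded, hence defines a real `r`.
    obtain ⟨t₁, ht₁⟩ := exists_rat_lt (((ofLex v₁ q₁ : k) : ℝ) / (ofLex w₀ q₁ : k))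
    obtain ⟨t₂, ht₂⟩ := exists_rat_gt (((ofLex v₂ q₁ : k) : ℝ) / (ofLex w₀ q₁ : k))
    rw [lt_div_iff₀ hc₀', ← ofLex_rat_smul] at ht₁
    rw [div_lt_iff₀ hc₀', ← ofLex_rat_smul] at ht₂
    have hmono : ∀ s t : ℚ, s ≤ t → t • w₀ ∈ D → s • w₀ ∈ D := by
      intro s t hst ht
      rcases hst.eq_or_lt with rfl | hst
      · exact ht
      refine hD _ (hline s) _ (hline t) (hlt _ (hline s) _ (hline t) ?_).le ht
      rw [← Subtype.coe_lt_coe, ofLex_rat_smul, ofLex_rat_smul]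
      exact mul_lt_mul_of_pos_right (by exact_mod_cast hst) hc₀'
    have ht₁D : t₁ • w₀ ∈ D := hD _ (hline _) _ hv₁W (hlt _ (hline _) _ hv₁W ht₁).le hv₁
    have ht₂D : t₂ • w₀ ∉ D := fun h =>
      hv₂ (hD _ hv₂W _ (hline _) (hlt _ hv₂W _ (hline _) ht₂).le h)
    have hT : T.Nonempty := ⟨t₁, t₁, rfl, ht₁D⟩
    have hTb : BddAbove T := by
      refine ⟨t₂, ?_⟩
      rintro _ ⟨t, rfl, ht⟩
      by_contra hcon
      exact ht₂D (hmono _ _ (by exact_mod_cast (not_le.1 hcon).le) ht)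
    obtain ⟨r, hr⟩ : ∃ r, sSup T = r := ⟨_, rfl⟩
    have hrlt : ∀ t : ℚ, (t : ℝ) < r → t • w₀ ∈ D := by
      intro t ht
      rw [← hr] at ht
      obtain ⟨_, ⟨s, rfl, hs⟩, hts⟩ := exists_lt_of_lt_csSup hT ht
      exact hmono _ _ (by exact_mod_cast hts.le) hs
    have hrgt : ∀ t : ℚ, r < t → t • w₀ ∉ D := by
      intro t ht hmem
      rw [← hr] at ht
      exact (le_csSup hTb ⟨t, rfl, hmem⟩).not_gt ht
    have hrk : r ∈ k := hk 0 W.zero_mem w₀ hw₀ r (fun t ht => by simpa using hrlt t ht)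
      fun t ht => by simpa using hrgt t ht
    -- `R` is the threshold at `q₁`: vectors of `W` with a smaller value there lie in `D`, those
    -- with a larger value do not. Only vectors with value exactly `R` remain undecided.
    obtain ⟨R, hR⟩ : ∃ R : k, (R : ℝ) = r * (ofLex w₀ q₁ : k) := ⟨⟨r, hrk⟩ * ofLex w₀ q₁, rfl⟩
    have hbelow : ∀ v ∈ W, ofLex v q₁ < R → v ∈ D := by
      intro v hv h
      have h' : ((ofLex v q₁ : k) : ℝ) / (ofLex w₀ q₁ : k) < r := by
        rw [div_lt_iff₀ hc₀', ← hR]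
        exact h
      obtain ⟨t, ht, ht'⟩ := exists_rat_btwn h'
      rw [div_lt_iff₀ hc₀', ← ofLex_rat_smul] at ht
      exact hD _ hv _ (hline t) (hlt _ hv _ (hline t) ht).le (hrlt t ht')
    have habove : ∀ v ∈ W, R < ofLex v q₁ → v ∉ D := by
      intro v hv h hmem
      have h' : r < ((ofLex v q₁ : k) : ℝ) / (ofLex w₀ q₁ : k) := by
        rw [lt_div_iff₀ hc₀', ← hR]
        exact h
      obtain ⟨t, ht, ht'⟩ := exists_rat_btwn h'
      rw [lt_div_iff₀ hc₀', ← ofLex_rat_smul] at ht'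
      exact hrgt t ht (hD _ (hline t) _ hv (hlt _ (hline t) _ hv ht').le hmem)
    have hfinish : ∀ b : Lex (ℚ →₀ k), (∀ q < q₁, ofLex b q = 0) → ofLex b q₁ = R →
        ∀ v ∈ W, ofLex v q₁ ≠ R → (v ∈ D → v < b) ∧ (v ∉ D → b < v) := by
      intro b hb hbR v hv hne
      have heq : ∀ q < q₁, ofLex v q = ofLex b q := fun q hq => by rw [hz v hv q hq, hb q hq]
      rcases lt_or_gt_of_ne hne with h | h
      · exact ⟨fun _ => lex_lt_of heq (hbR ▸ h), fun hn => absurd (hbelow v hv h) hn⟩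
      · exact ⟨fun hn => absurd hn (habove v hv h),
          fun _ => lex_lt_of (fun q hq => (heq q hq).symm) (hbR ▸ h)⟩
    by_cases hw : ∃ w ∈ W, ofLex w q₁ = R
    · obtain ⟨w, hwW, hwR⟩ := hw
      let W' : Submodule ℚ (Lex (ℚ →₀ k)) :=
        { carrier := {v | v ∈ W ∧ ofLex v q₁ = 0}
          add_mem' := fun {a b} ha hb => ⟨W.add_mem ha.1 hb.1, by
            rw [ofLex_add, Finsupp.add_apply, ha.2, hb.2, add_zero]⟩
          zero_mem' := ⟨W.zero_mem, rfl⟩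
          smul_mem' := fun t a ha => ⟨W.smul_mem t ha.1, by
            apply Subtype.ext
            rw [ofLex_rat_smul, ha.2]
            simp⟩ }
      -- Translation by `w` turns the undecided vectors into the subspace `W'`, supported on fewer
      -- coordinates. Taking `q₁` as the new lower barrier makes `b` vanish up to `q₁`, so adding it
      -- keeps the value `R`.
      obtain ⟨b, hb, hb'⟩ := ih W' {v | w + v ∈ D} q₁ hmin (fun v hv => hsupp' v hv.1 hv.2)
        (fun v hv v' hv' hle h => hD _ (W.add_mem hwW hv.1) _ (W.add_mem hwW hv'.1)
          (by gcongr) h)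
        (fun u hu x hx r h1 h2 => hk (w + u) (W.add_mem hwW hu.1) x hx.1 r
          (fun t ht => by rw [add_assoc]; exact h1 t ht)
          (fun t ht => by rw [add_assoc]; exact h2 t ht))
      have hwb : ∀ q < q₁, ofLex (w + b) q = 0 := fun q hq => by
        rw [ofLex_add, Finsupp.add_apply, hz w hwW q hq, hb q hq.le, add_zero]
      refine ⟨w + b, fun q hq => hwb q (hq.trans_lt hq₁), fun v hv => ?_⟩
      by_cases hvR : ofLex v q₁ = R
      · have hmem : v - w ∈ W' := ⟨W.sub_mem hv hwW, by
          rw [ofLex_sub, Finsupp.sub_apply, hvR, hwR, sub_self]⟩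
        have := hb' (v - w) hmem
        simp only [Set.mem_ofPred_eq, add_sub_cancel] at this
        exact ⟨fun h => sub_lt_iff_lt_add'.1 (this.1 h), fun h => lt_sub_iff_add_lt'.1 (this.2 h)⟩
      · exact hfinish _ hwb (by rw [ofLex_add, Finsupp.add_apply, hwR, hb q₁ le_rfl, add_zero])
          v hv hvR
    · push Not at hw
      have hb : ∀ q < q₁, ofLex (toLex (Finsupp.single q₁ R)) q = 0 :=
        fun q hq => Finsupp.single_eq_of_ne hq.ne
      exact ⟨toLex (Finsupp.single q₁ R), fun q hq => hb q (hq.trans_lt hq₁), fun v hv =>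
        hfinish _ hb Finsupp.single_eq_same v hv (hw v hv)⟩

end Cuts

end

noncomputable section

/-! ### Formulas expressing linear inequalities -/

open FirstOrder.Language

/-- The term with a given variable code, or `0` if the code is not that of a free variable. -/
def varTerm (m c : ℕ) : og.Term (Fin m ⊕ Fin 0) :=
  if h : c / 2 < m ∧ c % 2 = 0 then .var (.inl ⟨c / 2, h.1⟩) else .func OGFunc.zero Fin.elim0

/-- The sum of the variables with given codes, as a term. -/
def listTerm (m : ℕ) : List ℕ → og.Term (Fin m ⊕ Fin 0)
  | [] => .func OGFunc.zero Fin.elim0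
  | c :: l => .func OGFunc.add ![varTerm m c, listTerm m l]

/-- The formula expressing the inequality `∑ l < ∑ r`. -/
def ltForm (m : ℕ) (l r : List ℕ) : og.Formula (Fin m) :=
  .rel OGRel.lt ![listTerm m l, listTerm m r]

theorem realize_listTerm {G : Type} [AddCommGroup G] [LinearOrder G] {m : ℕ} (v : Fin m → G)
    (xs : Fin 0 → G) (l : List ℕ) :
    (listTerm m l).realize (Sum.elim v xs) = lsum (codeVal v) l := by
  induction l with
  | nil => rfl
  | cons c l ih =>
    have h : (varTerm m c).realize (Sum.elim v xs) = codeVal v c := by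
      unfold varTerm codeVal
      split_ifs <;> rfl
    rw [lsum_cons, ← ih, ← h]
    rfl

theorem realize_ltForm {G : Type} [AddCommGroup G] [LinearOrder G] {m : ℕ} (v : Fin m → G)
    (l r : List ℕ) : (ltForm m l r).Realize v ↔ lsum (codeVal v) l < lsum (codeVal v) r := by
  rw [← realize_listTerm v default, ← realize_listTerm v default]
  rfl

/-- The code of the formula expressing an inequality. -/
def ltCode (m : ℕ) (l r : List ℕ) : ℕ :=
  Nat.pair 2 (Nat.pair
    (l.foldr (fun c x => Nat.pair 3 (Nat.pair (bif decide (c / 2 < m) && decide (c % 2 = 0)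
      then Nat.pair 0 c else Nat.pair 1 0) x)) (Nat.pair 1 0))
    (r.foldr (fun c x => Nat.pair 3 (Nat.pair (bif decide (c / 2 < m) && decide (c % 2 = 0)
      then Nat.pair 0 c else Nat.pair 1 0) x)) (Nat.pair 1 0)))

theorem primrec_ltCode (m : ℕ) : Primrec fun e : List ℕ × List ℕ => ltCode m e.1 e.2 := by
  unfold ltCode; fun_prop

/-- With `primrec_ltCode`, this lets a decision procedure for a set of formulas be queried about
linear inequalities. -/
theorem formulaCode_ltForm (m : ℕ) (l r : List ℕ) :
    formulaCode (ltForm m l r) = ltCode m l r := by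
  have hvar : ∀ c, termCode varCode (varTerm m c) =
      bif decide (c / 2 < m) && decide (c % 2 = 0) then Nat.pair 0 c else Nat.pair 1 0 := by
    intro c
    rw [← Bool.decide_and, Bool.cond_decide]
    unfold varTerm
    split_ifs with h
    · rw [termCode, varCode]
      congr 1
      have := h.2
      simp only
      omega
    · rfl
  have hlist : ∀ l, termCode varCode (listTerm m l) =
      l.foldr (fun c x => Nat.pair 3 (Nat.pair (bif decide (c / 2 < m) && decide (c % 2 = 0)
        then Nat.pair 0 c else Nat.pair 1 0) x)) (Nat.pair 1 0) := by
    intro l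
    induction l with
    | nil => rfl
    | cons c l ih =>
      rw [listTerm, termCode, List.foldr_cons, ← ih, ← hvar]
      rfl
  rw [ltForm, formulaCode, ltCode, ← hlist, ← hlist]
  rfl

/-! ### Saturation -/

section Saturation

variable {S : Set (ℕ → Bool)} {k : Subfield ℝ} {n : ℕ}

/-- The type variable comes first and hence has code `0`, so varying the realization is an update at
`0`. -/
theorem codeVal_cons {G : Type} [AddCommGroup G] (b : G) (a : Fin n → G) :
    codeVal (Fin.cons b a : Fin (n + 1) → G) =
      Function.update (codeVal (Fin.cons 0 a : Fin (n + 1) → G)) 0 b := by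
  funext c
  rcases eq_or_ne c 0 with rfl | hc
  · rw [Function.update_self]
    exact codeVal_inl (Fin.cons b a : Fin (n + 1) → G) 0
  · rw [Function.update_of_ne hc]
    unfold codeVal
    split_ifs with h
    · obtain ⟨j, hj⟩ : ∃ j, (⟨c / 2, h.1⟩ : Fin (n + 1)) = Fin.succ j :=
        Fin.exists_succ_eq.2 (fun h0 => by
          have := congrArg Fin.val h0
          simp only [Fin.val_zero] at this
          omega) |>.imp fun _ h => h.symm
      rw [hj, Fin.cons_succ, Fin.cons_succ]
    · rfl

/-- Clears the denominator of the scalar; negative contributions move to the other side, so all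
coefficients stay natural numbers. It depends on the name `s`, not just its value, which makes the
scaling primitive recursive. -/
theorem mul_nsmul_ratVal_smul {M : Type*} [AddCommGroup M] [Module ℚ M] (s : ℕ × ℕ × ℕ) {c : ℕ}
    {v x y : M} (h : c • v = y - x) :
    ((s.2.2 + 1) * c) • (ratVal s • v) = (s.1 • y + s.2.1 • x) - (s.1 • x + s.2.1 • y) := by
  have h1 : ((s.2.2 + 1 : ℕ) : ℚ) * ratVal s = (s.1 : ℚ) - s.2.1 := by
    rw [ratVal_def]
    push_cast
    field_simp
  rw [mul_smul, smul_comm c, h, ← Nat.cast_smul_eq_nsmul ℚ, smul_smul, h1]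
  module

theorem mul_nsmul_add {M : Type*} [AddCommGroup M] {c c' : ℕ} {v v' x x' y y' : M}
    (h : c • v = y - x) (h' : c' • v' = y' - x') :
    (c' * c) • (v + v') = (c' • y + c • y') - (c' • x + c • x') := by
  have : (c' * c) • (v + v') = c' • (c • v) + c • (c' • v') := by module
  rw [this, h, h']
  module

/-- Elements of the rational span of a tuple as integral combinations up to a multiple. -/
theorem exists_lists_of_mem_span (a : Fin n → Lex (ℚ →₀ k)) {v : Lex (ℚ →₀ k)}
    (hv : v ∈ Submodule.span ℚ (Set.range a)) :
    ∃ (c : ℕ) (l r : List ℕ), 0 < c ∧ cnt 0 l = 0 ∧ cnt 0 r = 0 ∧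
      c • v = lsum (codeVal (Fin.cons 0 a : Fin (n + 1) → Lex (ℚ →₀ k))) r -
        lsum (codeVal (Fin.cons 0 a : Fin (n + 1) → Lex (ℚ →₀ k))) l := by
  induction hv using Submodule.span_induction with
  | mem v hv =>
    obtain ⟨i, rfl⟩ := hv
    refine ⟨1, [], [2 * ((i.succ : Fin (n + 1)) : ℕ)], one_pos, rfl, by simp [cnt], ?_⟩
    rw [lsum_cons, lsum_nil, codeVal_inl, Fin.cons_succ]
    simp
  | zero => exact ⟨1, [], [], one_pos, rfl, rfl, by simp [lsum_nil]⟩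
  | add v w _ _ hv hw =>
    obtain ⟨c, l, r, hc, hl, hr, h⟩ := hv
    obtain ⟨c', l', r', hc', hl', hr', h'⟩ := hw
    refine ⟨c' * c, rep c' l ++ rep c l', rep c' r ++ rep c r', Nat.mul_pos hc' hc,
      by simp [cnt_append, cnt_rep, hl, hl'], by simp [cnt_append, cnt_rep, hr, hr'], ?_⟩
    rw [lsum_append, lsum_append, lsum_rep, lsum_rep, lsum_rep, lsum_rep]
    exact mul_nsmul_add h h'
  | smul t v _ hv =>
    obtain ⟨c, l, r, hc, hl, hr, h⟩ := hv
    obtain ⟨s, rfl⟩ := ratVal_surjective t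
    refine ⟨(s.2.2 + 1) * c, rep s.1 l ++ rep s.2.1 r, rep s.1 r ++ rep s.2.1 l,
      Nat.mul_pos (Nat.succ_pos _) hc, by simp [cnt_append, cnt_rep, hl, hr],
      by simp [cnt_append, cnt_rep, hl, hr], ?_⟩
    rw [lsum_append, lsum_append, lsum_rep, lsum_rep, lsum_rep, lsum_rep]
    exact mul_nsmul_ratVal_smul s h

theorem lsum_mem_span (a : Fin n → Lex (ℚ →₀ k)) (l : List ℕ) :
    lsum (codeVal (Fin.cons 0 a : Fin (n + 1) → Lex (ℚ →₀ k))) l ∈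
      Submodule.span ℚ (Set.range a) := by
  induction l with
  | nil => exact Submodule.zero_mem _
  | cons c l ih =>
    rw [lsum_cons]
    refine Submodule.add_mem _ ?_ ih
    unfold codeVal
    split_ifs with h
    · refine Fin.cases ?_ (fun i => ?_) (⟨c / 2, h.1⟩ : Fin (n + 1))
      · exact Submodule.zero_mem _
      · exact Submodule.subset_span ⟨i, rfl⟩
    · exact Submodule.zero_mem _

theorem exists_finset_support_subset (a : Fin n → Lex (ℚ →₀ k)) :
    ∃ Q : Finset ℚ, ∀ w ∈ Submodule.span ℚ (Set.range a), (ofLex w).support ⊆ Q := by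
  refine ⟨Finset.univ.biUnion fun i => (ofLex (a i)).support, fun w hw q => ?_⟩
  contrapose
  intro hq
  simp only [Finset.mem_biUnion, Finset.mem_univ, true_and, not_exists,
    Finsupp.notMem_support_iff] at hq ⊢
  induction hw using Submodule.span_induction with
  | mem v hv =>
    obtain ⟨i, rfl⟩ := hv
    exact hq i
  | zero => rfl
  | add v w _ _ hv hw => rw [ofLex_add, Finsupp.add_apply, hv, hw, add_zero]
  | smul t v _ hv =>
    apply Subtype.ext
    rw [ofLex_rat_smul, hv]
    simp

theorem mem_span_of_nsmul_mem {W : Submodule ℚ (Lex (ℚ →₀ k))} {c : ℕ} (hc : c ≠ 0)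
    {v : Lex (ℚ →₀ k)} (h : c • v ∈ W) : v ∈ W := by
  have := W.smul_mem ((c : ℚ)⁻¹) h
  rwa [← Nat.cast_smul_eq_nsmul ℚ, inv_smul_smul₀ (by exact_mod_cast hc)] at this

/-- Computable complete types over a tuple that are finitely satisfiable are realized. -/
theorem IsScottSet.exists_realize_type (hS : IsScottSet S) (hk : (k : Set ℝ) = realsOf S)
    (a : Fin n → Lex (ℚ →₀ k)) {A : Set (og.Formula (Fin (n + 1)))}
    (hA : ComputableInSome S formulaCode A) (hcompl : ∀ φ, φ ∈ A ∨ φ.not ∈ A)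
    (hfin : ∀ F : Finset (og.Formula (Fin (n + 1))), (F : Set (og.Formula (Fin (n + 1)))) ⊆ A →
      ∃ b, ∀ φ ∈ F, φ.Realize (Fin.cons b a : Fin (n + 1) → Lex (ℚ →₀ k))) :
    ∃ b, ∀ φ ∈ A, φ.Realize (Fin.cons b a : Fin (n + 1) → Lex (ℚ →₀ k)) := by
  classical
  have hG := lex_isDivisible k
  obtain ⟨Sat, hSat⟩ : ∃ Sat : og.Formula (Fin (n + 1)) → Lex (ℚ →₀ k) → Prop, ∀ φ b,
    Sat φ b ↔ φ.Realize (Fin.cons b a : Fin (n + 1) → Lex (ℚ →₀ k)) := ⟨_, fun _ _ => Iff.rfl⟩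
  simp only [← hSat] at hfin ⊢
  have hnot : ∀ φ b, Sat φ.not b ↔ ¬ Sat φ b := fun φ b => by
    rw [hSat, hSat, FirstOrder.Language.Formula.realize_not]
  have hpair : ∀ φ ∈ A, ∀ ψ ∈ A, ∃ b, Sat φ b ∧ Sat ψ b := fun φ hφ ψ hψ => by
    obtain ⟨b, hb⟩ := hfin {φ, ψ} (by
      intro χ hχ
      rcases Finset.mem_insert.1 (Finset.mem_coe.1 hχ) with rfl | h
      · exact hφ
      · exact Finset.mem_singleton.1 h ▸ hψ)
    exact ⟨b, hb _ (by simp), hb _ (by simp)⟩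
  -- Completeness and finite satisfiability close `A` under consequence over the parameters `a`.
  have hmem : ∀ φ ∈ A, ∀ ψ, (∀ b, Sat φ b → Sat ψ b) → ψ ∈ A := fun φ hφ ψ h => by
    refine (hcompl ψ).resolve_right fun hψ => ?_
    obtain ⟨b, hb, hb'⟩ := hpair φ hφ _ hψ
    exact (hnot ψ b).1 hb' (h b hb)
  have hcode : ∀ φ, formulaCode φ ∈ formulaCode '' A ↔ φ ∈ A := fun φ => by
    refine ⟨?_, fun h => ⟨φ, h, rfl⟩⟩
    rintro ⟨ψ, hψ, h⟩
    refine hmem ψ hψ φ fun b hb => ?_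
    have hD := formDecode_formulaCode ψ
    rw [h, formDecode_formulaCode, Option.some.injEq] at hD
    rw [hSat, hG.realize_formula_iff] at hb ⊢
    rwa [hD]
  have hdec : DecIn S fun e : List ℕ × List ℕ => ltForm (n + 1) e.1 e.2 ∈ A := by
    refine (((hS.computableInSome_iff _ _).1 hA).comp hS (primrec_ltCode (n + 1))).of_iff
      fun e => ?_
    rw [← formulaCode_ltForm, hcode]
  set ρ : ℕ → Lex (ℚ →₀ k) := codeVal (Fin.cons 0 a : Fin (n + 1) → Lex (ℚ →₀ k)) with hρ
  have hSatlt : ∀ l r b, Sat (ltForm (n + 1) l r) b ↔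
      lsum (Function.update ρ 0 b) l < lsum (Function.update ρ 0 b) r := fun l r b => by
    rw [hSat, realize_ltForm, codeVal_cons, ← hρ]
  have hρ0 : Function.update ρ 0 0 = ρ := by rw [hρ, ← codeVal_cons]
  set W := Submodule.span ℚ (Set.range a) with hW
  -- Multiplying by `c` expresses `v < x` with integral coefficients, as `∑ r < c • x + ∑ l`.
  have hlow : ∀ c l r v, 0 < c → cnt 0 l = 0 → cnt 0 r = 0 → c • v = lsum ρ r - lsum ρ l →
      ∀ b, Sat (ltForm (n + 1) r (rep c [0] ++ l)) b ↔ v < b := by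
    intro c l r v hc hl hr h b
    have h1 : ∀ x y : Lex (ℚ →₀ k), c • x < c • y ↔ x < y := fun x y =>
      flagLT_nsmul (s := true) hc
    rw [hSatlt, lsum_append, lsum_rep, lsum_update _ _ _ r, lsum_update _ _ _ l, hl, hr, hρ0,
      zero_nsmul, zero_add, zero_add, lsum_cons, lsum_nil, Function.update_self, add_zero, ← h1 v b, h,
      sub_lt_iff_lt_add]
  have hupp : ∀ c l r v, 0 < c → cnt 0 l = 0 → cnt 0 r = 0 → c • v = lsum ρ r - lsum ρ l →
      ∀ b, Sat (ltForm (n + 1) (rep c [0] ++ l) r) b ↔ b < v := by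
    intro c l r v hc hl hr h b
    have h1 : ∀ x y : Lex (ℚ →₀ k), c • x < c • y ↔ x < y := fun x y =>
      flagLT_nsmul (s := true) hc
    rw [hSatlt, lsum_append, lsum_rep, lsum_update _ _ _ r, lsum_update _ _ _ l, hl, hr, hρ0,
      zero_nsmul, zero_add, zero_add, lsum_cons, lsum_nil, Function.update_self, add_zero, ← h1 b v, h,
      lt_sub_iff_add_lt]
  -- The lower half of the cut: the elements that the type forces below `x`.
  let D : Set (Lex (ℚ →₀ k)) := {v | ∃ φ ∈ A, ∀ b, Sat φ b → v < b}
  have hmemD : ∀ c l r v, 0 < c → cnt 0 l = 0 → cnt 0 r = 0 → c • v = lsum ρ r - lsum ρ l →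
      (v ∈ D ↔ ltForm (n + 1) r (rep c [0] ++ l) ∈ A) := by
    intro c l r v hc hl hr h
    constructor
    · rintro ⟨φ, hφ, hb⟩
      exact hmem φ hφ _ fun b hφb => (hlow c l r v hc hl hr h b).2 (hb b hφb)
    · exact fun hA => ⟨_, hA, fun b => (hlow c l r v hc hl hr h b).1⟩
  -- If two formulas of the type pin `x` to `v`, then `v` satisfies every other formula too, by
  -- finite satisfiability of the three together.
  by_cases heq : ∃ v ∈ W, ∃ φ ∈ A, ∃ ψ ∈ A, ∀ b, Sat φ b → Sat ψ b → b = v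
  · obtain ⟨v, -, φ, hφ, ψ, hψ, hv⟩ := heq
    refine ⟨v, fun χ hχ => ?_⟩
    obtain ⟨b, hb⟩ := hfin {φ, ψ, χ} (by
      intro θ hθ
      simp only [Finset.coe_insert, Finset.coe_singleton, Set.mem_insert_iff,
        Set.mem_singleton_iff] at hθ
      rcases hθ with rfl | rfl | rfl <;> assumption)
    rw [← hv b (hb _ (by simp)) (hb _ (by simp))]
    exact hb _ (by simp)
  -- If the type contained neither `v < x` nor `x < v`, it would contain both negations and force `x
  -- = v`, which is excluded now.
  have hnotD : ∀ v ∈ W, v ∉ D → ∃ φ ∈ A, ∀ b, Sat φ b → b < v := by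
    intro v hv hvD
    obtain ⟨c, l, r, hc, hl, hr, h⟩ := exists_lists_of_mem_span a hv
    rw [hmemD c l r v hc hl hr h] at hvD
    have h1 := (hcompl _).resolve_left hvD
    refine ⟨_, (hcompl (ltForm (n + 1) (rep c [0] ++ l) r)).resolve_right fun h2 => ?_,
      fun b => (hupp c l r v hc hl hr h b).1⟩
    refine heq ⟨v, hv, _, h1, _, h2, fun b hb1 hb2 => ?_⟩
    rw [hnot, hlow c l r v hc hl hr h, not_lt] at hb1
    rw [hnot, hupp c l r v hc hl hr h, not_lt] at hb2
    exact le_antisymm hb1 hb2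
  obtain ⟨Q, hQ⟩ := exists_finset_support_subset a
  obtain ⟨q₀, -, hq₀⟩ := Order.exists_between_finsets (lo := ∅) (hi := Q) (by simp)
  obtain ⟨b, -, hb⟩ := exists_realize_cut (k := k) Q W D q₀ hq₀ hQ
    (fun v _ v' _ hle ⟨φ, hφ, h⟩ => ⟨φ, hφ, fun b hb => hle.trans_lt (h b hb)⟩) (by
      intro u hu w hw r h1 h2
      rw [← SetLike.mem_coe, hk]
      -- The hypotheses leave membership of `u + r • w` in `D` open, so rational `r` is treated
      -- separately. Otherwise `t < r` amounts to `u + t • w ∈ D`, a query to `A` computed from the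
      -- name of `t`.
      by_cases hr : ∃ q : ℚ, (q : ℝ) = r
      · obtain ⟨q, rfl⟩ := hr
        exact hS.rat_mem_realsOf q
      rw [hS.mem_realsOf_iff]
      obtain ⟨c, l, r₁, hc, hl, hr₁, h⟩ := exists_lists_of_mem_span a hu
      obtain ⟨c', l', r', hc', hl', hr', h'⟩ := exists_lists_of_mem_span a hw
      have hprim : Primrec fun t : ℕ × ℕ × ℕ =>
          (rep ((t.2.2 + 1) * c') r₁ ++ rep c (rep t.1 r' ++ rep t.2.1 l'),
            rep ((t.2.2 + 1) * c' * c) [0] ++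
              (rep ((t.2.2 + 1) * c') l ++ rep c (rep t.1 l' ++ rep t.2.1 r'))) := by
        fun_prop
      refine (hdec.comp hS hprim).of_iff fun t => ?_
      rw [← hmemD _ _ _ (u + ratVal t • w) (Nat.mul_pos (Nat.mul_pos t.2.2.succ_pos hc') hc)
        (by simp [cnt_append, cnt_rep, hl, hl', hr'])
        (by simp [cnt_append, cnt_rep, hr₁, hl', hr'])]
      · rcases lt_trichotomy (ratVal t : ℝ) r with ht | ht | ht
        · exact iff_of_true ht (h1 _ ht)
        · exact absurd ⟨_, ht⟩ hr
        · exact iff_of_false ht.not_gt (h2 _ ht)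
      · have h3 := mul_nsmul_add h (mul_nsmul_ratVal_smul t h')
        simpa only [lsum_append, lsum_rep] using h3)
  refine ⟨b, fun ψ hψ => ?_⟩
  -- Each inequality bounds `x` by an element of `W` or does not involve `x` essentially, so one
  -- formula of the type makes its truth value agree with that at `b`.
  have hineq : ∀ e : Ineq, ∃ φ ∈ A, ∀ b', Sat φ b' →
      (e.Holds (Function.update ρ 0 b') ↔ e.Holds (Function.update ρ 0 b)) := by
    have := hG.isOrdered
    intro e
    rcases lt_trichotomy (cnt 0 e.2.1) (cnt 0 e.2.2) with he | he | he
    · obtain ⟨v, hv, hv'⟩ := hG.holds_lower ρ 0 e he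
      have hvW : v ∈ W := mem_span_of_nsmul_mem (c := cnt 0 e.2.2 - cnt 0 e.2.1) (by omega) (by
        rw [hv, hρ0]
        exact Submodule.sub_mem _ (lsum_mem_span a _) (lsum_mem_span a _))
      simp only [hv']
      by_cases hvD : v ∈ D
      · obtain ⟨φ, hφ, h⟩ := hvD
        exact ⟨φ, hφ, fun b' hb' => iff_of_true (flagLT_of_lt (h b' hb'))
          (flagLT_of_lt ((hb v hvW).1 ⟨φ, hφ, h⟩))⟩
      · obtain ⟨φ, hφ, h⟩ := hnotD v hvW hvD
        exact ⟨φ, hφ, fun b' hb' => iff_of_false (fun hc => (flagLT_le hc).not_gt (h b' hb'))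
          fun hc => (flagLT_le hc).not_gt ((hb v hvW).2 hvD)⟩
    · exact ⟨ψ, hψ, fun b' _ => by
        rw [Ineq.holds_update_of_cnt_eq _ _ _ _ he, Ineq.holds_update_of_cnt_eq _ _ _ _ he]⟩
    · obtain ⟨v, hv, hv'⟩ := hG.holds_upper ρ 0 e he
      have hvW : v ∈ W := mem_span_of_nsmul_mem (c := cnt 0 e.2.1 - cnt 0 e.2.2) (by omega) (by
        rw [hv, hρ0]
        exact Submodule.sub_mem _ (lsum_mem_span a _) (lsum_mem_span a _))
      simp only [hv']
      by_cases hvD : v ∈ D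
      · obtain ⟨φ, hφ, h⟩ := hvD
        exact ⟨φ, hφ, fun b' hb' => iff_of_false (fun hc => (flagLT_le hc).not_gt (h b' hb'))
          fun hc => (flagLT_le hc).not_gt ((hb v hvW).1 ⟨φ, hφ, h⟩)⟩
      · obtain ⟨φ, hφ, h⟩ := hnotD v hvW hvD
        exact ⟨φ, hφ, fun b' hb' => iff_of_true (flagLT_of_lt (h b' hb'))
          (flagLT_of_lt ((hb v hvW).2 hvD))⟩
  choose χ hχ hχ' using hineq
  -- Some `b'` satisfies `ψ` and agrees with `b` on all inequalities in the normal form of `ψ`; the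
  -- true clause at `b'` is therefore true at `b`.
  obtain ⟨b', hb'⟩ := hfin (insert ψ ((formDNF ψ).flatten.toFinset.image χ)) (by
    intro θ hθ
    rcases Finset.mem_insert.1 (Finset.mem_coe.1 hθ) with rfl | h
    · exact hψ
    · obtain ⟨e, -, rfl⟩ := Finset.mem_image.1 h
      exact hχ e)
  have hψb' := hb' ψ (Finset.mem_insert_self _ _)
  rw [hSat, hG.realize_formula_iff, codeVal_cons, ← hρ] at hψb' ⊢
  obtain ⟨C, hC, h⟩ := hψb'
  refine ⟨C, hC, fun e he => (hχ' e b' (hb' _ ?_)).1 (h e he)⟩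
  exact Finset.mem_insert_of_mem (Finset.mem_image_of_mem χ
    (List.mem_toFinset.2 (List.mem_flatten.2 ⟨C, hC, he⟩)))

end Saturation

theorem IsScottSet.isSSaturated {S : Set (ℕ → Bool)} (hS : IsScottSet S) {k : Subfield ℝ}
    (hk : (k : Set ℝ) = realsOf S) : IsSSaturated S (Lex (ℚ →₀ k)) where
  realized_computable n p hp := by
    obtain ⟨v, rfl⟩ := hp
    have : typeFormulas ((og.completeTheory (Lex (ℚ →₀ k))).typeOf v) = {φ | φ.Realize v} :=
      Set.ext fun φ => FirstOrder.Language.Theory.CompleteType.formula_mem_typeOf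
        (T := og.completeTheory (Lex (ℚ →₀ k))) (v := v)
    rw [this]
    exact hS.computableInSome_realized hk v
  computable_realized n p a hp hfin :=
    hS.exists_realize_type hk a hp (fun φ => p.mem_or_not_mem _) hfin

end

end ScottSets

theorem corollary1p9 (S : Set (ℕ → Bool)) (hS : ScottSets.IsScottSet S) :
    (∃ (G : Type) (_ : AddCommGroup G) (_ : LinearOrder G),
      ScottSets.IsDivisibleOrderedAbelianGroup G ∧ ScottSets.IsSSaturated S G) ∧
    ∃ k : Subfield ℝ, (k : Set ℝ) = ScottSets.realsOf S ∧
      ScottSets.IsDivisibleOrderedAbelianGroup (Lex (ℚ →₀ k)) ∧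
      ScottSets.IsSSaturated S (Lex (ℚ →₀ k)) :=
  have h := And.intro (ScottSets.lex_isDivisible hS.field) (hS.isSSaturated (k := hS.field) rfl)
  ⟨⟨Lex (ℚ →₀ hS.field), inferInstance, inferInstance, h⟩, hS.field, rfl, h⟩
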